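/- Let $A,B$ be quantum systems with Hilbert spaces of finite dimensions $d_A,d_B\ge 1$; every system carries a fixed orthonormal (incoherent) basis. A quantum channel is a completely positive trace-preserving linear map. A measurement on a system $S$ is a finite family $\mathcal M=\{M_x\}_{x\in X}$ of positive semidefinite operators with $\sum_xM_x=I$, identified with the channel $\mathcal M(\rho)=\sum_x\operatorname{tr}(M_x\rho)\,|x\rangle\langle x|_{S'}$, where $\{|x\rangle\}$ is the incoherent basis of the output system $S'$. For positive semidefinite $P,Q$ let $D(P\Vert Q)=\operatorname{tr}P\log P-\operatorname{tr}P\log Q$ if $\ker Q\subseteq\ker P$ and $D(P\Vert Q)=+\infty$ otherwise, and for measurements $\mathcal M,\mathcal N$ on $S$ with the same outcome set let $D_m(\mathcal M\Vert\mathcal N)=\frac1{\dim S}\sum_xD(M_x\Vert N_x)$. Let $\Delta$ be dephasing in the incoherent basis. A measurement is incoherent ($\mathcal M\in\mathbf{IM}$) if $\Delta(M_x)=M_x$ for all $x$; a channel $\mathcal F$ is detection-incoherent ($\mathcal F\in\mathbf{DIO}$) if $\Delta\circ\mathcal F=\Delta\circ\mathcal F\circ\Delta$. LOCC channels are the finite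 compositions of one-way LOCC channels $\sum_s\Phi_s\otimes\Psi_s$, in which one party applies an instrument and the other applies a channel depending on its outcome; a measurement on a bipartite system is an LOCC measurement if the channel $\rho\mapsto\sum_x\operatorname{tr}(M_x\rho)|x\rangle\langle x|\otimes|x\rangle\langle x|$, which gives the outcome to both parties, is LOCC. Let $\overline{\mathbf{LOCC}}$ and $\overline{\mathbf{LOCC}}_m$ be the closures of the set of LOCC channels and of the set of LOCC measurements. Define $$C_m(\mathcal M_A)=\min_{\mathcal F_A\in\mathbf{IM}}D_m(\mathcal M_A\Vert\mathcal F_A),\qquad E_m(\mathcal M_{AB})=\min_{\mathcal F\in\overline{\mathbf{LOCC}}_m(A:B)}D_m(\mathcal M_{AB}\Vert\mathcal F_{AB}),$$ and, for channels $\mathcal E_A$ from $A$ to $A'$ and $\mathcal E_{AB}$ from $AB$ to $A'B'$, $$C(\mathcal E_A)=\min_{\mathcal F\in\mathbf{DIO}}\ \max_{\mathcal M\in\mathbf{IM}(A'\widetilde A)}D_m\big(\mathcal M\circ(\mathcal E_A\otimes\mathrm{id}_{\widetilde A})\,\big\Vert\,\mathcal M\circ(\mathcal F_A\otimes\mathrm{id}_{\widetilde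 A})\big),$$ $$E(\mathcal E_{AB})=\min_{\mathcal F\in\overline{\mathbf{LOCC}}(A:B)}\ \max_{\mathcal M\in\overline{\mathbf{LOCC}}_m(A'\widetilde A:B'\widetilde B)}D_m\big(\mathcal M\circ(\mathcal E_{AB}\otimes\mathrm{id}_{\widetilde A\widetilde B})\,\big\Vert\,\mathcal M\circ(\mathcal F_{AB}\otimes\mathrm{id}_{\widetilde A\widetilde B})\big),$$ where $\mathcal F$ has the same input and output systems as $\mathcal E$, the maxima also run over all finite-dimensional ancillary systems $\widetilde A,\widetilde B$ and all finite outcome sets, and $\min$ and $\max$ are read as infimum and supremum in $[-\infty,+\infty]$. Then the powers of measurement channels reduce to the static measures: for every measurement $\mathcal N_A$ on $A$, $$C(\mathcal N_A)=C_m(\mathcal N_A),$$ and for every measurement $\mathcal N_{AB}$ on $AB$ with outcomes $(x,y)\in X\times Y$, whose output system is $A'B'$ with basis $|x\rangle_{A'}|y\rangle_{B'}$, $$E(\mathcal N_{AB})=E_m(\mathcal N_{AB}).$$ -/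

import Mathlib

open scoped ComplexOrder Kronecker

namespace QuantumMeasurement

/-- Linear maps from the operators on `ℂ^A` to the operators on `ℂ^A'`. A finite index type `A`
stands for the system with Hilbert space `ℂ^A`; its standard basis is the incoherent basis. -/
abbrev SuperOp (A A' : Type) : Type := Matrix A A ℂ →ₗ[ℂ] Matrix A' A' ℂ

section Channels

variable {A B A' B' : Type} [Fintype A] [DecidableEq A] [Fintype B] [DecidableEq B]

/-- The tensor product `Φ ⊗ Ψ` of two linear maps, given by its values on the matrix units
`|i⟩⟨j| ⊗ |k⟩⟨l|`. -/
noncomputable def tensorMap (Φ : SuperOp A A') (Ψ : SuperOp B B') :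
    SuperOp (A × B) (A' × B') where
  toFun X := ∑ i, ∑ j, ∑ k, ∑ l,
    X (i, k) (j, l) • (Φ (Matrix.single i j 1) ⊗ₖ Ψ (Matrix.single k l 1))
  map_add' X Y := by
    simp only [Matrix.add_apply, add_smul, Finset.sum_add_distrib]
  map_smul' c X := by
    simp only [Matrix.smul_apply, smul_eq_mul, mul_smul, Finset.smul_sum, RingHom.id_apply]

/-- `Φ ⊗ Ψ` acts on product operators as it should. -/
theorem tensorMap_kronecker (Φ : SuperOp A A') (Ψ : SuperOp B B')
    (P : Matrix A A ℂ) (Q : Matrix B B ℂ) : tensorMap Φ Ψ (P ⊗ₖ Q) = Φ P ⊗ₖ Ψ Q := by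
  have hs : ∀ {C C' : Type} [Fintype C] [DecidableEq C] (Θ : SuperOp C C') (R : Matrix C C ℂ),
      Θ R = ∑ i, ∑ j, R i j • Θ (Matrix.single i j 1) := by
    intro C C' _ _ Θ R
    conv_lhs => rw [Matrix.matrix_eq_sum_single R]
    simp only [map_sum]
    refine Finset.sum_congr rfl fun i _ => Finset.sum_congr rfl fun j _ => ?_
    rw [← map_smul, Matrix.smul_single, smul_eq_mul, mul_one]
  rw [hs Φ P, hs Ψ Q]
  ext ⟨a, b⟩ ⟨c, d⟩
  simp only [tensorMap, LinearMap.coe_mk, AddHom.coe_mk, Matrix.sum_apply, Matrix.smul_apply,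
    Matrix.kroneckerMap_apply, smul_eq_mul, Finset.sum_mul]
  simp only [Finset.mul_sum]
  exact Finset.sum_congr rfl fun _ _ => Finset.sum_congr rfl fun _ _ =>
    Finset.sum_congr rfl fun _ _ => Finset.sum_congr rfl fun _ _ => by ring

variable [Fintype A'] [DecidableEq A'] [Fintype B'] [DecidableEq B']

/-- Complete positivity: `Φ ⊗ id` is positive for every finite-dimensional ancilla. -/
def IsCP (Φ : SuperOp A A') : Prop :=
  ∀ (K : Type) [Fintype K] [DecidableEq K] (X : Matrix (A × K) (A × K) ℂ),
    X.PosSemidef → (tensorMap Φ (LinearMap.id : SuperOp K K) X).PosSemidef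

/-- Quantum channel: completely positive and trace preserving. -/
def IsChannel (Φ : SuperOp A A') : Prop :=
  IsCP Φ ∧ ∀ X : Matrix A A ℂ, (Φ X).trace = X.trace

/-- The dephasing channel in the incoherent basis. -/
noncomputable def dephase (A : Type) [Fintype A] [DecidableEq A] : SuperOp A A :=
  Matrix.diagonalLinearMap A ℂ ℂ ∘ₗ Matrix.diagLinearMap A ℂ ℂ

/-- Detection-incoherent operations: channels with `Δ ∘ F = Δ ∘ F ∘ Δ`. -/
def IsDIO (F : SuperOp A A') : Prop :=
  IsChannel F ∧ dephase A' ∘ₗ F = dephase A' ∘ₗ F ∘ₗ dephase A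

/-- `E_{AB} ⊗ id_{KL}`, regarded as a bipartite map between `AK : BL` and `A'K : B'L`. -/
noncomputable def extendBipartite (K L : Type) [Fintype K] [DecidableEq K] [Fintype L]
    [DecidableEq L] (E : SuperOp (A × B) (A' × B')) :
    SuperOp ((A × K) × (B × L)) ((A' × K) × (B' × L)) :=
  (Matrix.reindexLinearEquiv ℂ ℂ (Equiv.prodProdProdComm A' B' K L)
      (Equiv.prodProdProdComm A' B' K L)).toLinearMap ∘ₗ
    tensorMap E (LinearMap.id : SuperOp (K × L) (K × L)) ∘ₗ
    (Matrix.reindexLinearEquiv ℂ ℂ (Equiv.prodProdProdComm A K B L)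
      (Equiv.prodProdProdComm A K B L)).toLinearMap

end Channels

section LOCC

/-- Alice applies an instrument `(Φ_s)` and sends the outcome `s` to Bob, who applies the
channel `Ψ_s`. -/
def IsOneWayRight {A B A' B' : Type} [Fintype A] [DecidableEq A] [Fintype B] [DecidableEq B]
    [Fintype A'] [DecidableEq A'] [Fintype B'] [DecidableEq B']
    (F : SuperOp (A × B) (A' × B')) : Prop :=
  ∃ (S : Type) (_ : Fintype S) (Φ : S → SuperOp A A') (Ψ : S → SuperOp B B'),
    (∀ s, IsCP (Φ s)) ∧ IsChannel (∑ s, Φ s) ∧ (∀ s, IsChannel (Ψ s)) ∧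
    F = ∑ s, tensorMap (Φ s) (Ψ s)

/-- Bob applies an instrument `(Ψ_s)` and sends the outcome `s` to Alice, who applies the
channel `Φ_s`. -/
def IsOneWayLeft {A B A' B' : Type} [Fintype A] [DecidableEq A] [Fintype B] [DecidableEq B]
    [Fintype A'] [DecidableEq A'] [Fintype B'] [DecidableEq B']
    (F : SuperOp (A × B) (A' × B')) : Prop :=
  ∃ (S : Type) (_ : Fintype S) (Φ : S → SuperOp A A') (Ψ : S → SuperOp B B'),
    (∀ s, IsCP (Ψ s)) ∧ IsChannel (∑ s, Ψ s) ∧ (∀ s, IsChannel (Φ s)) ∧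
    F = ∑ s, tensorMap (Φ s) (Ψ s)

/-- LOCC channels from `A : B` to `A' : B'`: finite compositions of one-way right and one-way
left LOCC channels, through arbitrary intermediate bipartite systems. -/
inductive IsLOCC : ∀ {A B A' B' : Type} [Fintype A] [DecidableEq A] [Fintype B] [DecidableEq B]
    [Fintype A'] [DecidableEq A'] [Fintype B'] [DecidableEq B'],
    SuperOp (A × B) (A' × B') → Prop
  | right {A B A' B' : Type} [Fintype A] [DecidableEq A] [Fintype B] [DecidableEq B]
      [Fintype A'] [DecidableEq A'] [Fintype B'] [DecidableEq B']
      (F : SuperOp (A × B) (A' × B')) : IsOneWayRight F → IsLOCC F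
  | left {A B A' B' : Type} [Fintype A] [DecidableEq A] [Fintype B] [DecidableEq B]
      [Fintype A'] [DecidableEq A'] [Fintype B'] [DecidableEq B']
      (F : SuperOp (A × B) (A' × B')) : IsOneWayLeft F → IsLOCC F
  | comp {A B U V A' B' : Type} [Fintype A] [DecidableEq A] [Fintype B] [DecidableEq B]
      [Fintype U] [DecidableEq U] [Fintype V] [DecidableEq V]
      [Fintype A'] [DecidableEq A'] [Fintype B'] [DecidableEq B']
      (G : SuperOp (U × V) (A' × B')) (F : SuperOp (A × B) (U × V)) :
      IsLOCC G → IsLOCC F → IsLOCC (G ∘ₗ F)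

/-- The closure of the set of LOCC channels from `A : B` to `A' : B'`. The topology is that of
pointwise convergence, which is the norm topology since the space is finite-dimensional. -/
def IsClosedLOCC {A B A' B' : Type} [Fintype A] [DecidableEq A] [Fintype B] [DecidableEq B]
    [Fintype A'] [DecidableEq A'] [Fintype B'] [DecidableEq B']
    (F : SuperOp (A × B) (A' × B')) : Prop :=
  (F : Matrix (A × B) (A × B) ℂ → Matrix (A' × B') (A' × B') ℂ) ∈
    closure {f : Matrix (A × B) (A × B) ℂ → Matrix (A' × B') (A' × B') ℂ |
      ∃ G : SuperOp (A × B) (A' × B'), IsLOCC G ∧ f = ⇑G}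

end LOCC

section Measurements

variable {A B : Type} [Fintype A] [DecidableEq A] [Fintype B] [DecidableEq B]

/-- A quantum measurement on `A` with outcomes in `X`, given by its POVM elements. -/
def IsPOVM {X : Type} [Fintype X] (M : X → Matrix A A ℂ) : Prop :=
  (∀ x, (M x).PosSemidef) ∧ ∑ x, M x = 1

/-- The measurement channel `ρ ↦ ∑ x, tr (M x ρ) |x⟩⟨x|`. -/
noncomputable def measChannel {X : Type} [Fintype X] [DecidableEq X] (M : X → Matrix A A ℂ) :
    SuperOp A X where
  toFun ρ := Matrix.diagonal fun x => (M x * ρ).trace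
  map_add' ρ σ := by
    rw [Matrix.diagonal_add]
    simp only [Matrix.mul_add, Matrix.trace_add]
  map_smul' c ρ := by
    rw [RingHom.id_apply, ← Matrix.diagonal_smul]
    simp only [Matrix.mul_smul, Matrix.trace_smul, Pi.smul_def]

/-- The POVM elements of the measurement `M ∘ E`, that is, the images of the elements of `M` under
the adjoint of `E`: the `(i, j)` entry of the operator `N` is `tr (N |j⟩⟨i|)`. -/
noncomputable def preprocess {X A' : Type} [Fintype A'] (M : X → Matrix A' A' ℂ)
    (E : SuperOp A A') (x : X) : Matrix A A ℂ :=
  Matrix.of fun i j => (M x * E (Matrix.single j i 1)).trace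

/-- The measurement channel of `preprocess M E` is the composition `M ∘ E`. -/
theorem measChannel_preprocess {X A' : Type} [Fintype X] [DecidableEq X] [Fintype A']
    [DecidableEq A'] (M : X → Matrix A' A' ℂ) (E : SuperOp A A') :
    measChannel (preprocess M E) = measChannel M ∘ₗ E := by
  refine Matrix.ext_linearMap ℂ fun i j => LinearMap.ext_ring ?_
  simp only [LinearMap.comp_apply, measChannel, LinearMap.coe_mk, AddHom.coe_mk]
  congr 1
  ext x
  simp [preprocess, Matrix.trace_mul_single]

/-- Incoherent measurements: all POVM elements are diagonal in the incoherent basis. -/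
def IsIncoherentMeas {X : Type} [Fintype X] (M : X → Matrix A A ℂ) : Prop :=
  IsPOVM M ∧ ∀ x, dephase A (M x) = M x

/-- LOCC measurements on `A : B`: measurements such that the channel
`ρ ↦ ∑ x, tr (M x ρ) |x⟩⟨x| ⊗ |x⟩⟨x|`, which gives the outcome to both parties, is LOCC. -/
def IsLOCCMeas {X : Type} [Fintype X] [DecidableEq X]
    (M : X → Matrix (A × B) (A × B) ℂ) : Prop :=
  IsPOVM M ∧ ∃ G : SuperOp (A × B) (X × X), IsLOCC G ∧
    ∀ ρ, G ρ = ∑ x, (M x * ρ).trace • (Matrix.single x x (1 : ℂ) ⊗ₖ Matrix.single x x (1 : ℂ))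

/-- The closure of the set of LOCC measurements on `A : B` with outcomes in `X`. -/
def IsClosedLOCCMeas {X : Type} [Fintype X] [DecidableEq X]
    (M : X → Matrix (A × B) (A × B) ℂ) : Prop :=
  M ∈ closure {F : X → Matrix (A × B) (A × B) ℂ | IsLOCCMeas F}

end Measurements

section Entropies

variable {A B : Type} [Fintype A] [DecidableEq A] [Fintype B] [DecidableEq B]

open Classical in
/-- Quantum relative entropy (in bits) of positive semidefinite operators,
`D(P‖Q) = tr P log P - tr P log Q` if `ker Q ⊆ ker P`, and `+∞` otherwise. It may be negative,
as the traces may differ. -/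
noncomputable def relEntropy (P Q : Matrix A A ℂ) : EReal :=
  if ∀ v : A → ℂ, Q.mulVec v = 0 → P.mulVec v = 0 then
    (((P * cfc Real.log P).trace.re - (P * cfc Real.log Q).trace.re) / Real.log 2 : ℝ)
  else ⊤

/-- Measurement relative entropy `D_m(M‖N) = (1/d) ∑ x, D(M x‖N x)`. -/
noncomputable def measRelEntropy {X : Type} [Fintype X] (M N : X → Matrix A A ℂ) : EReal :=
  (((Fintype.card A : ℝ)⁻¹ : ℝ) : EReal) * ∑ x, relEntropy (M x) (N x)

/-- Relative entropy of measurement-coherence `C_m`. -/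
noncomputable def measCoherence {X : Type} [Fintype X] (M : X → Matrix A A ℂ) : EReal :=
  ⨅ (F : X → Matrix A A ℂ) (_ : IsIncoherentMeas F), measRelEntropy M F

/-- Relative entropy of measurement-entanglement `E_m`. -/
noncomputable def measEntanglement {X : Type} [Fintype X] [DecidableEq X]
    (M : X → Matrix (A × B) (A × B) ℂ) : EReal :=
  ⨅ (F : X → Matrix (A × B) (A × B) ℂ) (_ : IsClosedLOCCMeas F), measRelEntropy M F

/-- Measurement-cohering power: `min` over detection-incoherent `F` and `max` over all ancillas
`K` and incoherent measurements `M` on `A'K` of `D_m(M ∘ (E ⊗ id)‖M ∘ (F ⊗ id))`. -/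
noncomputable def cohPower {A' : Type} [Fintype A'] [DecidableEq A'] (E : SuperOp A A') : EReal :=
  ⨅ (F : SuperOp A A') (_ : IsDIO F),
    ⨆ (K : Type) (_ : Fintype K) (_ : DecidableEq K) (_ : Nonempty K) (X : Type) (_ : Fintype X)
      (M : X → Matrix (A' × K) (A' × K) ℂ) (_ : IsIncoherentMeas M),
      measRelEntropy (preprocess M (tensorMap E (LinearMap.id : SuperOp K K)))
        (preprocess M (tensorMap F (LinearMap.id : SuperOp K K)))

/-- Measurement-entangling power: `min` over closed-LOCC channels `F` and `max` over all ancillas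
`K`, `L` and closed-LOCC measurements `M` on `A'K : B'L` of
`D_m(M ∘ (E ⊗ id)‖M ∘ (F ⊗ id))`. -/
noncomputable def entPower {A' B' : Type} [Fintype A'] [DecidableEq A'] [Fintype B']
    [DecidableEq B'] (E : SuperOp (A × B) (A' × B')) : EReal :=
  ⨅ (F : SuperOp (A × B) (A' × B')) (_ : IsClosedLOCC F),
    ⨆ (K : Type) (_ : Fintype K) (_ : DecidableEq K) (_ : Nonempty K)
      (L : Type) (_ : Fintype L) (_ : DecidableEq L) (_ : Nonempty L)
      (X : Type) (_ : Fintype X) (_ : DecidableEq X)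
      (M : X → Matrix ((A' × K) × (B' × L)) ((A' × K) × (B' × L)) ℂ) (_ : IsClosedLOCCMeas M),
      measRelEntropy (preprocess M (extendBipartite K L E))
        (preprocess M (extendBipartite K L F))

end Entropies

end QuantumMeasurement

/-! Upper bound. A free measurement `F` gives a free channel `measChannel F`, so it suffices to
bound every test of `measChannel N` against `measChannel F`. The output register is classical, so a
joint measurement `M` on register and ancilla sees only its diagonal blocks `T z x` and has
effective elements `∑ x, N x ⊗ T z x`, with `∑ z, T z x = 1`. Joint subadditivity of `D`
(`relEntropy_add_le`) and `D(P ⊗ T‖Q ⊗ T) = tr T · D(P‖Q)` (`relEntropy_kronecker`) bound the sum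
over `z` by the dimension of the ancilla times `∑ x, D(N x‖F x)`, and the normalization of `D_m`
absorbs that dimension. This is the data processing inequality `measRelEntropy_kronecker_le`.

Lower bound. For a free channel `F`, test with a trivial ancilla and the measurement of the
incoherent basis, which is incoherent and, on `X × Y`, local. It turns `measChannel N` back into `N`
and `F` into a free measurement, so the test value is at least the static measure of `N`.

The analytic core is subadditivity. Up to the divergent term `tr P · log R`, which is additive in
`P`, the relative entropy is the limit of integrals over `[0, R]` of `resolventSum`. For each `s >
0` this integrand is the maximum over matrices `η` of `quadFunctional`, which is linear in the pair
`(P, Q)`; a maximum of linear functionals is subadditive. -/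

open scoped ComplexOrder Kronecker

namespace QuantumMeasurement

/-! ### Spectral form of the relative entropy -/

section Diagonalization

variable {n m : Type} [Fintype n] [DecidableEq n] [Fintype m] [DecidableEq m]

/-- The unitary `U` and the real numbers `p` diagonalize `P`. -/
def Diagonalizes (U : Matrix n n ℂ) (p : n → ℝ) (P : Matrix n n ℂ) : Prop :=
  U.conjTranspose * U = 1 ∧ P = U * Matrix.diagonal (fun i => (p i : ℂ)) * U.conjTranspose

theorem Diagonalizes.mul_conjTranspose {U : Matrix n n ℂ} {p : n → ℝ} {P : Matrix n n ℂ}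
    (h : Diagonalizes U p P) : U * U.conjTranspose = 1 :=
  mul_eq_one_comm.mp h.1

theorem exists_diagonalizes {P : Matrix n n ℂ} (hP : P.PosSemidef) :
    ∃ U p, Diagonalizes U p P ∧ ∀ i, 0 ≤ p i := by
  refine ⟨hP.1.eigenvectorUnitary, hP.1.eigenvalues, ⟨?_, ?_⟩, hP.eigenvalues_nonneg⟩
  · exact Unitary.coe_star_mul_self hP.1.eigenvectorUnitary
  · conv_lhs => rw [hP.1.spectral_theorem, Unitary.conjStarAlgAut_apply]
    rfl

/-- If `V` is the eigenvector unitary chosen by the spectral theorem, `Vᴴ U` intertwines the two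
diagonal matrices of eigenvalues. Its nonzero entries therefore join equal eigenvalues, so it also
intertwines their images under any `f`. Arbitrary diagonalizations, such as Kronecker products, can
thus be used to compute logarithms. -/
theorem Diagonalizes.cfc_eq {U : Matrix n n ℂ} {p : n → ℝ} {P : Matrix n n ℂ}
    (h : Diagonalizes U p P) (hP : P.PosSemidef) (f : ℝ → ℝ) :
    cfc f P = U * Matrix.diagonal (fun i => (f (p i) : ℂ)) * U.conjTranspose := by
  rw [hP.1.cfc_eq, Matrix.IsHermitian.cfc, Unitary.conjStarAlgAut_apply]
  have hVV : (hP.1.eigenvectorUnitary : Matrix n n ℂ).conjTranspose *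
      (hP.1.eigenvectorUnitary : Matrix n n ℂ) = 1 :=
    Unitary.coe_star_mul_self hP.1.eigenvectorUnitary
  have hPV : P = (hP.1.eigenvectorUnitary : Matrix n n ℂ) *
      Matrix.diagonal (fun i => (hP.1.eigenvalues i : ℂ)) *
      (hP.1.eigenvectorUnitary : Matrix n n ℂ).conjTranspose := by
    conv_lhs => rw [hP.1.spectral_theorem, Unitary.conjStarAlgAut_apply]
    rfl
  change (hP.1.eigenvectorUnitary : Matrix n n ℂ) *
    Matrix.diagonal (fun i => (f (hP.1.eigenvalues i) : ℂ)) *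
      (hP.1.eigenvectorUnitary : Matrix n n ℂ).conjTranspose = _
  generalize (hP.1.eigenvectorUnitary : Matrix n n ℂ) = V at *
  generalize hP.1.eigenvalues = l at *
  have hVV' : V * V.conjTranspose = 1 := mul_eq_one_comm.mp hVV
  have hUU' := h.mul_conjTranspose
  have hint : (V.conjTranspose * U) * Matrix.diagonal (fun i => (p i : ℂ)) =
      Matrix.diagonal (fun i => (l i : ℂ)) * (V.conjTranspose * U) := by
    have h1 : P * U = U * Matrix.diagonal (fun i => (p i : ℂ)) := by
      rw [h.2, Matrix.mul_assoc, h.1, Matrix.mul_one]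
    have h2 : V.conjTranspose * P = Matrix.diagonal (fun i => (l i : ℂ)) * V.conjTranspose := by
      rw [hPV, ← Matrix.mul_assoc, ← Matrix.mul_assoc, hVV, Matrix.one_mul]
    rw [Matrix.mul_assoc, ← h1, ← Matrix.mul_assoc, h2, Matrix.mul_assoc]
  have hint' : (V.conjTranspose * U) * Matrix.diagonal (fun i => (f (p i) : ℂ)) =
      Matrix.diagonal (fun i => (f (l i) : ℂ)) * (V.conjTranspose * U) := by
    ext i j
    have := congrFun (congrFun hint i) j
    rw [Matrix.mul_diagonal, Matrix.diagonal_mul] at this ⊢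
    by_cases hz : (V.conjTranspose * U) i j = 0
    · rw [hz]; ring
    · have : p j = l i := by
        rw [mul_comm] at this
        exact_mod_cast mul_right_cancel₀ hz this
      rw [this, mul_comm]
  calc V * Matrix.diagonal (fun i => (f (l i) : ℂ)) * V.conjTranspose
      = V * (Matrix.diagonal (fun i => (f (l i) : ℂ)) * (V.conjTranspose * U)) *
          U.conjTranspose := by
        simp only [Matrix.mul_assoc, hUU', Matrix.mul_one]
    _ = (V * V.conjTranspose) * U * Matrix.diagonal (fun i => (f (p i) : ℂ)) *
          U.conjTranspose := by rw [← hint']; simp only [Matrix.mul_assoc]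
    _ = _ := by rw [hVV', Matrix.one_mul]

theorem Diagonalizes.kronecker {U : Matrix n n ℂ} {p : n → ℝ} {P : Matrix n n ℂ}
    {V : Matrix m m ℂ} {q : m → ℝ} {Q : Matrix m m ℂ}
    (h : Diagonalizes U p P) (h' : Diagonalizes V q Q) :
    Diagonalizes (U ⊗ₖ V) (fun i => p i.1 * q i.2) (P ⊗ₖ Q) := by
  constructor
  · rw [Matrix.conjTranspose_kronecker, ← Matrix.mul_kronecker_mul, h.1, h'.1,
      Matrix.one_kronecker_one]
  · rw [h.2, h'.2, Matrix.mul_kronecker_mul, Matrix.mul_kronecker_mul,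
      Matrix.diagonal_kronecker_diagonal, Matrix.conjTranspose_kronecker]
    simp

theorem Diagonalizes.submatrix {U : Matrix n n ℂ} {p : n → ℝ} {P : Matrix n n ℂ}
    (h : Diagonalizes U p P) (e : m ≃ n) :
    Diagonalizes (U.submatrix e e) (fun i => p (e i)) (P.submatrix e e) := by
  constructor
  · rw [Matrix.conjTranspose_submatrix, Matrix.submatrix_mul_equiv, h.1,
      Matrix.submatrix_one_equiv]
  · have hd : Matrix.diagonal (fun i => (p (e i) : ℂ)) =
        (Matrix.diagonal (fun i => (p i : ℂ))).submatrix e e := by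
      rw [Matrix.submatrix_diagonal_equiv]; rfl
    rw [hd, Matrix.conjTranspose_submatrix, Matrix.submatrix_mul_equiv,
      Matrix.submatrix_mul_equiv, ← h.2]

theorem Diagonalizes.trace_eq {U : Matrix n n ℂ} {p : n → ℝ} {P : Matrix n n ℂ}
    (h : Diagonalizes U p P) : P.trace.re = ∑ i, p i := by
  rw [h.2, Matrix.trace_mul_comm, ← Matrix.mul_assoc, h.1, Matrix.one_mul, Matrix.trace_diagonal,
    Complex.re_sum]
  simp

/-- The matrix of inner products between two orthonormal bases. -/
noncomputable def overlap (U V : Matrix n n ℂ) : Matrix n n ℂ := V.conjTranspose * U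

/-- The overlap matrix is unitary. This normalization converts sums over the spectrum of `P` alone
into double sums weighted by squared overlaps. -/
theorem sum_overlap_normSq {U V : Matrix n n ℂ} (hU : U.conjTranspose * U = 1)
    (hV : V.conjTranspose * V = 1) (i : n) :
    ∑ j, ‖overlap U V j i‖ ^ 2 = 1 := by
  have h : (overlap U V).conjTranspose * overlap U V = 1 := by
    have hV' : V * V.conjTranspose = 1 := mul_eq_one_comm.mp hV
    rw [overlap, Matrix.conjTranspose_mul, Matrix.conjTranspose_conjTranspose,
      Matrix.mul_assoc, ← Matrix.mul_assoc V, hV', Matrix.one_mul, hU]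
  have h2 := congrFun (congrFun h i) i
  rw [Matrix.mul_apply, Matrix.one_apply_eq] at h2
  have h3 : ∀ j, (overlap U V).conjTranspose i j * overlap U V j i =
      ((‖overlap U V j i‖ ^ 2 : ℝ) : ℂ) := by
    intro j
    rw [Matrix.conjTranspose_apply, Complex.star_def, Complex.conj_mul']
    push_cast; rfl
  simp only [h3] at h2
  exact_mod_cast h2

theorem trace_mul_diagonalizes {U V P Q : Matrix n n ℂ} {p q : n → ℝ}
    (h : Diagonalizes U p P) (h' : Diagonalizes V q Q) :
    (P * Q).trace.re = ∑ i, ∑ j, ‖overlap U V j i‖ ^ 2 * (p i * q j) := by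
  have h1 : (P * Q).trace = (Matrix.diagonal (fun i => (p i : ℂ)) * ((overlap U V).conjTranspose *
      Matrix.diagonal (fun i => (q i : ℂ)) * overlap U V)).trace := by
    rw [h.2, h'.2, overlap, Matrix.conjTranspose_mul, Matrix.conjTranspose_conjTranspose,
      Matrix.mul_assoc, Matrix.mul_assoc, Matrix.trace_mul_comm U]
    simp only [Matrix.mul_assoc]
  rw [h1, Matrix.trace, Complex.re_sum]
  refine Finset.sum_congr rfl fun i _ => ?_
  rw [Matrix.diag_apply, Matrix.diagonal_mul, Matrix.mul_apply, Finset.mul_sum, Complex.re_sum]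
  refine Finset.sum_congr rfl fun j _ => ?_
  rw [Matrix.mul_diagonal, Matrix.conjTranspose_apply, Complex.star_def]
  have : (p i : ℂ) * ((starRingEnd ℂ) (overlap U V j i) * q j * overlap U V j i) =
      ((‖overlap U V j i‖ ^ 2 * (p i * q j) : ℝ) : ℂ) := by
    push_cast
    rw [← Complex.conj_mul']; ring
  rw [this, Complex.ofReal_re]

/-- The kernel condition in terms of diagonalizations. -/
theorem ker_le_iff {U V P Q : Matrix n n ℂ} {p q : n → ℝ}
    (h : Diagonalizes U p P) (h' : Diagonalizes V q Q) :
    (∀ v : n → ℂ, Q.mulVec v = 0 → P.mulVec v = 0) ↔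
      ∀ i j, q j = 0 → p i = 0 ∨ overlap U V j i = 0 := by
  have hUV : U.conjTranspose * V = (overlap U V).conjTranspose := by
    rw [overlap, Matrix.conjTranspose_mul, Matrix.conjTranspose_conjTranspose]
  have hV' := h'.mul_conjTranspose
  constructor
  · intro H i j hj
    have h1 : Q.mulVec (V.mulVec (Pi.single j 1)) = 0 := by
      rw [Matrix.mulVec_mulVec, h'.2, Matrix.mul_assoc, h'.1, Matrix.mul_one,
        ← Matrix.mulVec_mulVec]
      have : (Matrix.diagonal fun i => (q i : ℂ)).mulVec (Pi.single j 1) = 0 := by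
        ext k
        rw [Matrix.mulVec_diagonal]
        by_cases hk : k = j
        · subst hk; simp [hj]
        · simp [hk]
      rw [this, Matrix.mulVec_zero]
    have h2 := H _ h1
    have h3 : U.conjTranspose.mulVec (P.mulVec (V.mulVec (Pi.single j 1))) = 0 := by
      rw [h2, Matrix.mulVec_zero]
    have h0 : U.conjTranspose * P * V =
        Matrix.diagonal (fun i => (p i : ℂ)) * (overlap U V).conjTranspose := by
      rw [h.2, ← hUV, ← Matrix.mul_assoc, ← Matrix.mul_assoc, h.1, Matrix.one_mul,
        Matrix.mul_assoc]
    rw [Matrix.mulVec_mulVec, Matrix.mulVec_mulVec, h0] at h3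
    have h4 := congrFun h3 i
    rw [Matrix.mulVec_single_one, Matrix.col_apply, Matrix.diagonal_mul,
      Matrix.conjTranspose_apply] at h4
    simpa using h4
  · intro H v hv
    have h1 : ∀ j, (q j : ℂ) * (V.conjTranspose.mulVec v) j = 0 := by
      intro j
      have : V.conjTranspose.mulVec (Q.mulVec v) = 0 := by rw [hv, Matrix.mulVec_zero]
      rw [Matrix.mulVec_mulVec, h'.2, ← Matrix.mul_assoc, ← Matrix.mul_assoc, h'.1,
        Matrix.one_mul, ← Matrix.mulVec_mulVec] at this
      have := congrFun this j
      rwa [Matrix.mulVec_diagonal] at this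
    have h2 : P.mulVec v = U.mulVec ((Matrix.diagonal fun i => (p i : ℂ)).mulVec
        ((overlap U V).conjTranspose.mulVec (V.conjTranspose.mulVec v))) := by
      simp only [← hUV, Matrix.mulVec_mulVec]
      conv_lhs => rw [h.2]
      simp only [Matrix.mul_assoc, hV', Matrix.mul_one]
    have h3 : (Matrix.diagonal fun i => (p i : ℂ)).mulVec
        ((overlap U V).conjTranspose.mulVec (V.conjTranspose.mulVec v)) = 0 := by
      ext i
      rw [Matrix.mulVec_diagonal, Matrix.mulVec, dotProduct, Finset.mul_sum]
      refine Finset.sum_eq_zero fun j _ => ?_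
      rcases mul_eq_zero.mp (h1 j) with hq | hz
      · rcases H i j (by exact_mod_cast hq) with hp | ho
        · simp [hp]
        · simp [ho]
      · simp [hz]
    rw [h2, h3, Matrix.mulVec_zero]

open Classical in
/-- The relative entropy in terms of diagonalizations of both arguments. -/
theorem relEntropy_eq_of_diagonalizes {U V P Q : Matrix n n ℂ} {p q : n → ℝ}
    (hP : P.PosSemidef) (hQ : Q.PosSemidef)
    (h : Diagonalizes U p P) (h' : Diagonalizes V q Q) :
    relEntropy P Q = if ∀ i j, q j = 0 → p i = 0 ∨ overlap U V j i = 0 then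
      (((∑ i, ∑ j, ‖overlap U V j i‖ ^ 2 * (p i * (Real.log (p i) - Real.log (q j)))) /
        Real.log 2 : ℝ) : EReal) else ⊤ := by
  rw [relEntropy]
  simp only [ker_le_iff h h']
  have e1 : (P * cfc Real.log P).trace.re = ∑ i, p i * Real.log (p i) := by
    have hd : Diagonalizes U (fun i => p i * Real.log (p i)) (P * cfc Real.log P) := by
      refine ⟨h.1, ?_⟩
      rw [h.cfc_eq hP]
      conv_lhs => rw [h.2]
      rw [Matrix.mul_assoc, ← Matrix.mul_assoc U.conjTranspose, ← Matrix.mul_assoc U.conjTranspose,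
        h.1, Matrix.one_mul, ← Matrix.mul_assoc, Matrix.mul_assoc U, Matrix.diagonal_mul_diagonal]
      simp
    exact hd.trace_eq
  have e2 : (P * cfc Real.log Q).trace.re =
      ∑ i, ∑ j, ‖overlap U V j i‖ ^ 2 * (p i * Real.log (q j)) :=
    trace_mul_diagonalizes h ⟨h'.1, h'.cfc_eq hQ _⟩
  have e3 : ∑ i, p i * Real.log (p i) =
      ∑ i, ∑ j, ‖overlap U V j i‖ ^ 2 * (p i * Real.log (p i)) := by
    refine Finset.sum_congr rfl fun i _ => ?_
    rw [← Finset.sum_mul, sum_overlap_normSq h.1 h'.1, one_mul]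
  rw [e1, e2, e3, ← Finset.sum_sub_distrib]
  simp only [← Finset.sum_sub_distrib, ← mul_sub]

end Diagonalization

/-! ### Variational formula for the integrand -/

section Subadditivity

variable {n : Type} [Fintype n] [DecidableEq n]

/-- The concave quadratic functional whose supremum over `η` is the integrand `resolventSum`. -/
noncomputable def quadFunctional (s : ℝ) (P Q η : Matrix n n ℂ) : ℝ :=
  2 * (P * η).trace.re - (η.conjTranspose * Q * η).trace.re - s * (η * P * η.conjTranspose).trace.re

-- Linearity in the pair `(P, Q)` for fixed `η` is what makes the maximum over `η` subadditive.
omit [DecidableEq n] in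
theorem quadFunctional_add (s : ℝ) (P P' Q Q' η : Matrix n n ℂ) :
    quadFunctional s (P + P') (Q + Q') η = quadFunctional s P Q η + quadFunctional s P' Q' η := by
  simp only [quadFunctional, Matrix.add_mul, Matrix.mul_add, Matrix.trace_add, Complex.add_re]
  ring

/-- The sum `∑ i j, |⟨v_j|u_i⟩|² p_i² / (q_j + s p_i)`. -/
noncomputable def resolventSum (U V : Matrix n n ℂ) (p q : n → ℝ) (s : ℝ) : ℝ :=
  ∑ i, ∑ j, ‖overlap U V j i‖ ^ 2 * (p i ^ 2 / (q j + s * p i))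

theorem trace_conj_diagonal_mul (d : n → ℝ) (η : Matrix n n ℂ) :
    (η.conjTranspose * Matrix.diagonal (fun i => (d i : ℂ)) * η).trace.re =
      ∑ i, ∑ j, d j * ‖η j i‖ ^ 2 := by
  rw [Matrix.trace, Complex.re_sum]
  refine Finset.sum_congr rfl fun i _ => ?_
  rw [Matrix.diag_apply, Matrix.mul_apply, Complex.re_sum]
  refine Finset.sum_congr rfl fun j _ => ?_
  rw [Matrix.mul_diagonal, Matrix.conjTranspose_apply, Complex.star_def]
  have : (starRingEnd ℂ) (η j i) * d j * η j i = ((d j * ‖η j i‖ ^ 2 : ℝ) : ℂ) := by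
    push_cast
    rw [← Complex.conj_mul']; ring
  rw [this, Complex.ofReal_re]

/-- Writing the argument in the eigenbases of `Q` (left) and `P` (right) decouples the functional
into one scalar quadratic per entry of `η`. -/
theorem quadFunctional_eq {U V P Q : Matrix n n ℂ} {p q : n → ℝ}
    (h : Diagonalizes U p P) (h' : Diagonalizes V q Q) (s : ℝ) (η : Matrix n n ℂ) :
    quadFunctional s P Q (V * η * U.conjTranspose) =
      ∑ i, ∑ j, (2 * (p i * ((starRingEnd ℂ) (overlap U V j i) * η j i).re) -
        (q j + s * p i) * ‖η j i‖ ^ 2) := by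
  have hV := h'.1
  have hU := h.1
  have e1 : (P * (V * η * U.conjTranspose)).trace.re =
      ∑ i, ∑ j, p i * ((starRingEnd ℂ) (overlap U V j i) * η j i).re := by
    have : (P * (V * η * U.conjTranspose)).trace =
        (Matrix.diagonal (fun i => (p i : ℂ)) * ((overlap U V).conjTranspose * η)).trace := by
      rw [h.2, overlap, Matrix.conjTranspose_mul, Matrix.conjTranspose_conjTranspose,
        ← Matrix.mul_assoc, Matrix.trace_mul_comm]
      simp only [← Matrix.mul_assoc]
      rw [hU, Matrix.one_mul]
    rw [this, Matrix.trace, Complex.re_sum]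
    refine Finset.sum_congr rfl fun i _ => ?_
    rw [Matrix.diag_apply, Matrix.diagonal_mul, Matrix.mul_apply, Complex.re_ofReal_mul,
      Complex.re_sum, Finset.mul_sum]
    rfl
  have e2 : ((V * η * U.conjTranspose).conjTranspose * Q * (V * η * U.conjTranspose)).trace.re =
      ∑ i, ∑ j, q j * ‖η j i‖ ^ 2 := by
    rw [← trace_conj_diagonal_mul]
    congr 1
    have : (V * η * U.conjTranspose).conjTranspose * Q * (V * η * U.conjTranspose) =
        U * (η.conjTranspose * ((V.conjTranspose * V) * Matrix.diagonal (fun i => (q i : ℂ)) *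
          (V.conjTranspose * V)) * η * U.conjTranspose) := by
      conv_lhs => rw [h'.2]
      simp only [Matrix.conjTranspose_mul, Matrix.conjTranspose_conjTranspose, Matrix.mul_assoc]
    rw [this, hV, Matrix.one_mul, Matrix.mul_one, Matrix.trace_mul_comm, Matrix.mul_assoc, hU,
      Matrix.mul_one]
  have e3 : ((V * η * U.conjTranspose) * P * (V * η * U.conjTranspose).conjTranspose).trace.re =
      ∑ i, ∑ j, p i * ‖η j i‖ ^ 2 := by
    have h1 : ((V * η * U.conjTranspose) * P * (V * η * U.conjTranspose).conjTranspose).trace =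
        (η.conjTranspose.conjTranspose * Matrix.diagonal (fun i => (p i : ℂ)) *
          η.conjTranspose).trace := by
      have : (V * η * U.conjTranspose) * P * (V * η * U.conjTranspose).conjTranspose =
          V * (η * ((U.conjTranspose * U) * Matrix.diagonal (fun i => (p i : ℂ)) *
            (U.conjTranspose * U)) * η.conjTranspose * V.conjTranspose) := by
        conv_lhs => rw [h.2]
        simp only [Matrix.conjTranspose_mul, Matrix.conjTranspose_conjTranspose, Matrix.mul_assoc]
      rw [this, hU, Matrix.one_mul, Matrix.mul_one, Matrix.trace_mul_comm, Matrix.mul_assoc, hV,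
        Matrix.mul_one, Matrix.conjTranspose_conjTranspose]
    rw [h1, trace_conj_diagonal_mul, Finset.sum_comm]
    simp only [Matrix.conjTranspose_apply, norm_star]
  rw [quadFunctional, e1, e2, e3, Finset.mul_sum, Finset.mul_sum, ← Finset.sum_sub_distrib,
    ← Finset.sum_sub_distrib]
  refine Finset.sum_congr rfl fun i _ => ?_
  rw [Finset.mul_sum, Finset.mul_sum, ← Finset.sum_sub_distrib, ← Finset.sum_sub_distrib]
  refine Finset.sum_congr rfl fun j _ => ?_
  ring

theorem quadFunctional_le {U V P Q : Matrix n n ℂ} {p q : n → ℝ}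
    (h : Diagonalizes U p P) (h' : Diagonalizes V q Q) (hp : ∀ i, 0 ≤ p i) (hq : ∀ i, 0 ≤ q i)
    {s : ℝ} (hs : 0 < s) (η : Matrix n n ℂ) :
    quadFunctional s P Q η ≤ resolventSum U V p q s := by
  have hη : η = V * (V.conjTranspose * η * U) * U.conjTranspose := by
    have hU := h.mul_conjTranspose
    have hV := h'.mul_conjTranspose
    simp only [← Matrix.mul_assoc, hV, Matrix.one_mul]
    rw [Matrix.mul_assoc, hU, Matrix.mul_one]
  rw [hη, quadFunctional_eq h h']
  refine Finset.sum_le_sum fun i _ => Finset.sum_le_sum fun j _ => ?_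
  generalize (V.conjTranspose * η * U) j i = z
  generalize overlap U V j i = c
  have hre : ((starRingEnd ℂ) c * z).re ≤ ‖c‖ * ‖z‖ :=
    (Complex.re_le_norm _).trans (by rw [norm_mul, Complex.norm_conj])
  have hpi := hp i
  have hqj := hq j
  rcases hpi.eq_or_lt with h0 | h0
  -- Here the denominator may be `0`, but the right-hand side vanishes anyway because its numerator
  -- does.
  · rw [← h0]
    have : 0 ≤ q j * ‖z‖ ^ 2 := by positivity
    simp only [mul_zero, zero_mul, add_zero]
    simp only [ne_eq, OfNat.ofNat_ne_zero, not_false_eq_true, zero_pow, zero_div, mul_zero]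
    linarith
  · have hd : 0 < q j + s * p i := by positivity
    rw [← mul_div_assoc, le_div_iff₀ hd]
    have h1 := mul_le_mul_of_nonneg_left hre (mul_nonneg hpi hd.le)
    -- Completing the square, after multiplication by the denominator.
    nlinarith [sq_nonneg (‖c‖ * p i - (q j + s * p i) * ‖z‖)]

theorem exists_quadFunctional_eq {U V P Q : Matrix n n ℂ} {p q : n → ℝ}
    (h : Diagonalizes U p P) (h' : Diagonalizes V q Q) (hp : ∀ i, 0 ≤ p i) (hq : ∀ i, 0 ≤ q i)
    {s : ℝ} (hs : 0 < s) :
    ∃ η, quadFunctional s P Q η = resolventSum U V p q s := by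
  -- The entrywise maximizer: the stationary point of each scalar quadratic.
  refine ⟨V * (Matrix.of fun j i => ((p i / (q j + s * p i) : ℝ) : ℂ) * overlap U V j i) *
    U.conjTranspose, ?_⟩
  rw [quadFunctional_eq h h']
  refine Finset.sum_congr rfl fun i _ => Finset.sum_congr rfl fun j _ => ?_
  rw [Matrix.of_apply]
  generalize overlap U V j i = c
  have hpi := hp i
  have hqj := hq j
  have h1 : (starRingEnd ℂ) c * (((p i / (q j + s * p i) : ℝ) : ℂ) * c) =
      ((p i / (q j + s * p i) * ‖c‖ ^ 2 : ℝ) : ℂ) := by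
    rw [mul_left_comm, Complex.conj_mul']
    push_cast; rfl
  rw [h1, Complex.ofReal_re, norm_mul, Complex.norm_real, Real.norm_eq_abs, mul_pow, sq_abs]
  rcases hpi.eq_or_lt with h0 | h0
  · rw [← h0]; simp
  · have hd : q j + s * p i ≠ 0 := by positivity
    field_simp
    ring

/-- Subadditivity of `resolventSum`. -/
theorem resolventSum_add_le {U V P Q U₁ V₁ P₁ Q₁ U₂ V₂ P₂ Q₂ : Matrix n n ℂ}
    {p q p₁ q₁ p₂ q₂ : n → ℝ}
    (h : Diagonalizes U p P) (h' : Diagonalizes V q Q) (hp : ∀ i, 0 ≤ p i) (hq : ∀ i, 0 ≤ q i)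
    (h₁ : Diagonalizes U₁ p₁ P₁) (h₁' : Diagonalizes V₁ q₁ Q₁)
    (hp₁ : ∀ i, 0 ≤ p₁ i) (hq₁ : ∀ i, 0 ≤ q₁ i)
    (h₂ : Diagonalizes U₂ p₂ P₂) (h₂' : Diagonalizes V₂ q₂ Q₂)
    (hp₂ : ∀ i, 0 ≤ p₂ i) (hq₂ : ∀ i, 0 ≤ q₂ i)
    (hP : P = P₁ + P₂) (hQ : Q = Q₁ + Q₂) {s : ℝ} (hs : 0 < s) :
    resolventSum U V p q s ≤ resolventSum U₁ V₁ p₁ q₁ s + resolventSum U₂ V₂ p₂ q₂ s := by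
  obtain ⟨η, hη⟩ := exists_quadFunctional_eq h h' hp hq hs
  rw [← hη, hP, hQ, quadFunctional_add]
  exact add_le_add (quadFunctional_le h₁ h₁' hp₁ hq₁ hs η) (quadFunctional_le h₂ h₂' hp₂ hq₂ hs η)

/-! ### Integral representation and joint subadditivity -/

open Filter Topology

theorem intervalIntegrable_sq_div {p q : ℝ} (hp : 0 < p) (hq : 0 < q) {R : ℝ} (hR : 0 ≤ R) :
    IntervalIntegrable (fun s => p ^ 2 / (q + s * p)) MeasureTheory.volume 0 R := by
  apply ContinuousOn.intervalIntegrable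
  refine ContinuousOn.div (by fun_prop) (by fun_prop) fun s hs => ?_
  rw [Set.uIcc_of_le hR] at hs
  have := mul_nonneg hs.1 hp.le
  positivity

theorem integral_sq_div {p q : ℝ} (hp : 0 < p) (hq : 0 < q) {R : ℝ} (hR : 0 ≤ R) :
    ∫ s in (0 : ℝ)..R, p ^ 2 / (q + s * p) = p * Real.log (q + R * p) - p * Real.log q := by
  rw [intervalIntegral.integral_eq_sub_of_hasDerivAt (f := fun s => p * Real.log (q + s * p)) _
    (intervalIntegrable_sq_div hp hq hR)]
  · simp
  · intro s hs
    rw [Set.uIcc_of_le hR] at hs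
    have hd : q + s * p ≠ 0 := by
      have := mul_nonneg hs.1 hp.le
      positivity
    have h1 : HasDerivAt (fun s : ℝ => q + s * p) p s := by
      simpa using ((hasDerivAt_id s).mul_const p).const_add q
    exact ((h1.log hd).const_mul p).congr_deriv (by rw [sq, mul_div_assoc])

/-- Factoring `q + R p = R (q / R + p)` isolates the divergence `p log R`; the remaining logarithm
tends to `log p`. -/
theorem tendsto_integral_sq_div {p q : ℝ} (hp : 0 < p) (hq : 0 < q) :
    Tendsto (fun R => (∫ s in (0 : ℝ)..R, p ^ 2 / (q + s * p)) - p * Real.log R) atTop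
      (𝓝 (p * (Real.log p - Real.log q))) := by
  have h1 : Tendsto (fun R : ℝ => q / R + p) atTop (𝓝 p) := by
    simpa using (tendsto_const_nhds.div_atTop tendsto_id).add_const p
  have h2 := (((Real.continuousAt_log hp.ne').tendsto.comp h1).sub_const (Real.log q)).const_mul p
  refine h2.congr' ?_
  filter_upwards [eventually_gt_atTop 0] with R hR
  rw [integral_sq_div hp hq hR.le, Function.comp_apply]
  have h3 : q + R * p = R * (q / R + p) := by field_simp
  rw [h3, Real.log_mul hR.ne' (by positivity)]
  ring

theorem intervalIntegrable_finsetSum {ι : Type} {S : Finset ι} {f : ι → ℝ → ℝ} {a b : ℝ}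
    (h : ∀ i ∈ S, IntervalIntegrable (f i) MeasureTheory.volume a b) :
    IntervalIntegrable (fun s => ∑ i ∈ S, f i s) MeasureTheory.volume a b := by
  have hf : (fun s => ∑ i ∈ S, f i s) = ∑ i ∈ S, f i := by
    ext s
    simp
  rw [hf]
  exact IntervalIntegrable.sum S h

/-- For `q = 0 < p` the fraction is `p / s`, not integrable at `0`; the kernel condition `hc`
ensures that its weight `c`, a squared overlap in the application, is then zero. -/
theorem intervalIntegrable_overlap_term {p q c : ℝ} (hp : 0 ≤ p) (hq : 0 ≤ q)
    (hc : q = 0 → p = 0 ∨ c = 0) {R : ℝ} (hR : 0 ≤ R) :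
    IntervalIntegrable (fun s => c * (p ^ 2 / (q + s * p))) MeasureTheory.volume 0 R := by
  rcases hp.eq_or_lt with h0 | h0
  · simp [← h0]
  rcases hq.eq_or_lt with h1 | h1
  · rcases hc h1.symm with h2 | h2
    · exact absurd h2 h0.ne'
    · simp [h2]
  · exact (intervalIntegrable_sq_div h0 h1 hR).const_mul c

theorem tendsto_overlap_term {p q c : ℝ} (hp : 0 ≤ p) (hq : 0 ≤ q)
    (hc : q = 0 → p = 0 ∨ c = 0) :
    Tendsto (fun R => (∫ s in (0 : ℝ)..R, c * (p ^ 2 / (q + s * p))) - c * p * Real.log R) atTop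
      (𝓝 (c * (p * (Real.log p - Real.log q)))) := by
  rcases hp.eq_or_lt with h0 | h0
  · simp [← h0]
  rcases hq.eq_or_lt with h1 | h1
  · rcases hc h1.symm with h2 | h2
    · exact absurd h2 h0.ne'
    · simp [h2]
  · refine ((tendsto_integral_sq_div h0 h1).const_mul c).congr fun R => ?_
    rw [intervalIntegral.integral_const_mul]
    ring

omit [DecidableEq n] in
theorem intervalIntegrable_resolventSum {U V : Matrix n n ℂ} {p q : n → ℝ}
    (hp : ∀ i, 0 ≤ p i) (hq : ∀ i, 0 ≤ q i)
    (hc : ∀ i j, q j = 0 → p i = 0 ∨ overlap U V j i = 0) {R : ℝ} (hR : 0 ≤ R) :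
    IntervalIntegrable (resolventSum U V p q) MeasureTheory.volume 0 R := by
  unfold resolventSum
  refine intervalIntegrable_finsetSum fun i _ => intervalIntegrable_finsetSum fun j _ => ?_
  exact intervalIntegrable_overlap_term (hp i) (hq j)
    (fun h => (hc i j h).imp id fun h => by simp [h]) hR

/-- Integral representation of the relative entropy. -/
theorem tendsto_integral_resolventSum {U V P Q : Matrix n n ℂ} {p q : n → ℝ}
    (h : Diagonalizes U p P) (h' : Diagonalizes V q Q)
    (hp : ∀ i, 0 ≤ p i) (hq : ∀ i, 0 ≤ q i)
    (hc : ∀ i j, q j = 0 → p i = 0 ∨ overlap U V j i = 0) :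
    Tendsto (fun R => (∫ s in (0 : ℝ)..R, resolventSum U V p q s) - P.trace.re * Real.log R) atTop
      (𝓝 (∑ i, ∑ j, ‖overlap U V j i‖ ^ 2 * (p i * (Real.log (p i) - Real.log (q j))))) := by
  have hc' : ∀ i j, q j = 0 → p i = 0 ∨ ‖overlap U V j i‖ ^ 2 = 0 :=
    fun i j h => (hc i j h).imp id fun h => by simp [h]
  refine (tendsto_finsetSum Finset.univ fun i _ => tendsto_finsetSum Finset.univ fun j _ =>
    tendsto_overlap_term (hp i) (hq j) (hc' i j)).congr' ?_
  filter_upwards [eventually_ge_atTop 0] with R hR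
  unfold resolventSum
  rw [intervalIntegral.integral_finsetSum fun i _ => intervalIntegrable_finsetSum fun j _ =>
    intervalIntegrable_overlap_term (hp i) (hq j) (hc' i j) hR, h.trace_eq, Finset.sum_mul,
    ← Finset.sum_sub_distrib]
  refine Finset.sum_congr rfl fun i _ => ?_
  rw [intervalIntegral.integral_finsetSum fun j _ =>
    intervalIntegrable_overlap_term (hp i) (hq j) (hc' i j) hR, Finset.sum_sub_distrib]
  congr 1
  rw [← Finset.sum_mul, ← Finset.sum_mul, sum_overlap_normSq h.1 h'.1, one_mul]

-- The two nonnegative quadratic forms add up to zero at `v`, so each vanishes, and a positive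
-- semidefinite form vanishes only on its kernel.
omit [DecidableEq n] in
theorem ker_of_ker_add {Q Q' : Matrix n n ℂ} (hQ : Q.PosSemidef) (hQ' : Q'.PosSemidef)
    {v : n → ℂ} (hv : (Q + Q').mulVec v = 0) : Q.mulVec v = 0 := by
  rw [← hQ.dotProduct_mulVec_zero_iff]
  have h1 := hQ.dotProduct_mulVec_nonneg v
  have h2 := hQ'.dotProduct_mulVec_nonneg v
  have h3 : star v ⬝ᵥ Q.mulVec v + star v ⬝ᵥ Q'.mulVec v = 0 := by
    rw [← dotProduct_add, ← Matrix.add_mulVec, hv, dotProduct_zero]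
  exact ((add_eq_zero_iff_of_nonneg h1 h2).mp h3).1

theorem relEntropy_ne_bot (P Q : Matrix n n ℂ) : relEntropy P Q ≠ ⊥ := by
  unfold relEntropy
  split_ifs
  · exact EReal.coe_ne_bot _
  · simp

/-- Joint subadditivity (equivalently, joint convexity) of the quantum relative entropy. -/
theorem relEntropy_add_le {P₁ Q₁ P₂ Q₂ : Matrix n n ℂ} (hP₁ : P₁.PosSemidef) (hQ₁ : Q₁.PosSemidef)
    (hP₂ : P₂.PosSemidef) (hQ₂ : Q₂.PosSemidef) :
    relEntropy (P₁ + P₂) (Q₁ + Q₂) ≤ relEntropy P₁ Q₁ + relEntropy P₂ Q₂ := by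
  by_cases hk₁ : ∀ v : n → ℂ, Q₁.mulVec v = 0 → P₁.mulVec v = 0
  swap
  · have : relEntropy P₁ Q₁ = ⊤ := if_neg hk₁
    rw [this, EReal.top_add_of_ne_bot (relEntropy_ne_bot _ _)]
    exact le_top
  by_cases hk₂ : ∀ v : n → ℂ, Q₂.mulVec v = 0 → P₂.mulVec v = 0
  swap
  · have : relEntropy P₂ Q₂ = ⊤ := if_neg hk₂
    rw [this, EReal.add_top_of_ne_bot (relEntropy_ne_bot _ _)]
    exact le_top
  have hk : ∀ v : n → ℂ, (Q₁ + Q₂).mulVec v = 0 → (P₁ + P₂).mulVec v = 0 := by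
    intro v hv
    rw [Matrix.add_mulVec, hk₁ v (ker_of_ker_add hQ₁ hQ₂ hv),
      hk₂ v (ker_of_ker_add hQ₂ hQ₁ (by rwa [add_comm])), add_zero]
  have hP := hP₁.add hP₂
  have hQ := hQ₁.add hQ₂
  obtain ⟨U, p, h, hp⟩ := exists_diagonalizes hP
  obtain ⟨V, q, h', hq⟩ := exists_diagonalizes hQ
  obtain ⟨U₁, p₁, h₁, hp₁⟩ := exists_diagonalizes hP₁
  obtain ⟨V₁, q₁, h₁', hq₁⟩ := exists_diagonalizes hQ₁
  obtain ⟨U₂, p₂, h₂, hp₂⟩ := exists_diagonalizes hP₂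
  obtain ⟨V₂, q₂, h₂', hq₂⟩ := exists_diagonalizes hQ₂
  have hc := (ker_le_iff h h').mp hk
  have hc₁ := (ker_le_iff h₁ h₁').mp hk₁
  have hc₂ := (ker_le_iff h₂ h₂').mp hk₂
  rw [relEntropy_eq_of_diagonalizes hP hQ h h', relEntropy_eq_of_diagonalizes hP₁ hQ₁ h₁ h₁',
    relEntropy_eq_of_diagonalizes hP₂ hQ₂ h₂ h₂', if_pos hc, if_pos hc₁, if_pos hc₂,
    ← EReal.coe_add, EReal.coe_le_coe_iff, ← add_div]
  refine div_le_div_of_nonneg_right ?_ (Real.log_nonneg one_le_two)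
  -- The subtracted terms `tr P · log R` agree on both sides, so only the integrals have to be
  -- compared. The comparison is made on the open interval, as the variational formula needs `s >
  -- 0`.
  refine le_of_tendsto_of_tendsto (tendsto_integral_resolventSum h h' hp hq hc)
    ((tendsto_integral_resolventSum h₁ h₁' hp₁ hq₁ hc₁).add
      (tendsto_integral_resolventSum h₂ h₂' hp₂ hq₂ hc₂)) ?_
  filter_upwards [eventually_ge_atTop 0] with R hR
  have i₁ := intervalIntegrable_resolventSum hp₁ hq₁ hc₁ hR
  have i₂ := intervalIntegrable_resolventSum hp₂ hq₂ hc₂ hR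
  have := intervalIntegral.integral_mono_on_of_le_Ioo hR
    (intervalIntegrable_resolventSum hp hq hc hR) (i₁.add i₂) fun s hs =>
      resolventSum_add_le h h' hp hq h₁ h₁' hp₁ hq₁ h₂ h₂' hp₂ hq₂ rfl rfl hs.1
  rw [intervalIntegral.integral_add i₁ i₂] at this
  rw [Matrix.trace_add, Complex.add_re, add_mul]
  linarith

theorem relEntropy_zero_zero : relEntropy (0 : Matrix n n ℂ) 0 = 0 := by
  simp [relEntropy]

theorem relEntropy_sum_le {ι : Type} (S : Finset ι) {P Q : ι → Matrix n n ℂ}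
    (hP : ∀ i, (P i).PosSemidef) (hQ : ∀ i, (Q i).PosSemidef) :
    relEntropy (∑ i ∈ S, P i) (∑ i ∈ S, Q i) ≤ ∑ i ∈ S, relEntropy (P i) (Q i) := by
  classical
  induction S using Finset.induction_on with
  | empty => simp [relEntropy_zero_zero]
  | insert a S ha ih =>
    rw [Finset.sum_insert ha, Finset.sum_insert ha, Finset.sum_insert ha]
    exact (relEntropy_add_le (hP a) (hQ a) (Matrix.posSemidef_sum _ fun i _ => hP i)
      (Matrix.posSemidef_sum _ fun i _ => hQ i)).trans (add_le_add le_rfl ih)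

end Subadditivity

/-! ### Invariance, tensor factors and data processing -/

section DataProcessing

variable {n m : Type} [Fintype n] [DecidableEq n] [Fintype m] [DecidableEq m]

theorem posSemidef_kronecker {P : Matrix n n ℂ} {Q : Matrix m m ℂ}
    (hP : P.PosSemidef) (hQ : Q.PosSemidef) : (P ⊗ₖ Q).PosSemidef := by
  obtain ⟨U, p, h, hp⟩ := exists_diagonalizes hP
  obtain ⟨V, q, h', hq⟩ := exists_diagonalizes hQ
  rw [(h.kronecker h').2]
  refine Matrix.PosSemidef.mul_mul_conjTranspose_same (Matrix.PosSemidef.diagonal fun i => ?_) _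
  change (0 : ℂ) ≤ ((p i.1 * q i.2 : ℝ) : ℂ)
  exact_mod_cast mul_nonneg (hp i.1) (hq i.2)

omit [DecidableEq n] [DecidableEq m] in
theorem overlap_submatrix (U V : Matrix n n ℂ) (e : m ≃ n) :
    overlap (U.submatrix e e) (V.submatrix e e) = (overlap U V).submatrix e e := by
  rw [overlap, overlap, Matrix.conjTranspose_submatrix, Matrix.submatrix_mul_equiv]

theorem relEntropy_submatrix {P Q : Matrix n n ℂ} (hP : P.PosSemidef) (hQ : Q.PosSemidef)
    (e : m ≃ n) : relEntropy (P.submatrix e e) (Q.submatrix e e) = relEntropy P Q := by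
  obtain ⟨U, p, h, -⟩ := exists_diagonalizes hP
  obtain ⟨V, q, h', -⟩ := exists_diagonalizes hQ
  rw [relEntropy_eq_of_diagonalizes hP hQ h h',
    relEntropy_eq_of_diagonalizes (hP.submatrix e) (hQ.submatrix e) (h.submatrix e)
      (h'.submatrix e), overlap_submatrix]
  have h1 : (∀ i j, q (e j) = 0 → p (e i) = 0 ∨ (overlap U V).submatrix e e j i = 0) ↔
      ∀ i j, q j = 0 → p i = 0 ∨ overlap U V j i = 0 := by
    constructor
    · intro H i j
      simpa using H (e.symm i) (e.symm j)
    · intro H i j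
      exact H (e i) (e j)
  have h2 : ∑ i, ∑ j, ‖(overlap U V).submatrix e e j i‖ ^ 2 *
      (p (e i) * (Real.log (p (e i)) - Real.log (q (e j)))) =
      ∑ i, ∑ j, ‖overlap U V j i‖ ^ 2 * (p i * (Real.log (p i) - Real.log (q j))) := by
    rw [← e.sum_comp]
    refine Finset.sum_congr rfl fun i _ => ?_
    rw [← e.sum_comp]
    rfl
  simp only [h1, h2]

theorem measRelEntropy_submatrix {Z : Type} [Fintype Z] {M N : Z → Matrix n n ℂ}
    (hM : ∀ z, (M z).PosSemidef) (hN : ∀ z, (N z).PosSemidef) (e : m ≃ n) :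
    measRelEntropy (fun z => (M z).submatrix e e) (fun z => (N z).submatrix e e) =
      measRelEntropy M N := by
  unfold measRelEntropy
  rw [Fintype.card_congr e]
  simp only [relEntropy_submatrix (hM _) (hN _)]

-- With the same second factor on both sides, only equal eigenvectors of it overlap, so the double
-- sum over its spectrum collapses to a single sum.
omit [DecidableEq n] in
theorem overlap_kronecker_self (U V : Matrix n n ℂ) {W : Matrix m m ℂ}
    (hW : W.conjTranspose * W = 1) :
    overlap (U ⊗ₖ W) (V ⊗ₖ W) = overlap U V ⊗ₖ 1 := by
  rw [overlap, overlap, Matrix.conjTranspose_kronecker, ← Matrix.mul_kronecker_mul, hW]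

/-- `D(P ⊗ T ‖ Q ⊗ T) = tr T · D(P ‖ Q)` when the right-hand side is finite. -/
theorem relEntropy_kronecker {P Q : Matrix n n ℂ} {T : Matrix m m ℂ} (hP : P.PosSemidef)
    (hQ : Q.PosSemidef) (hT : T.PosSemidef) {r : ℝ} (hr : relEntropy P Q = r) :
    relEntropy (P ⊗ₖ T) (Q ⊗ₖ T) = ((T.trace.re * r : ℝ) : EReal) := by
  obtain ⟨U, p, h, -⟩ := exists_diagonalizes hP
  obtain ⟨V, q, h', -⟩ := exists_diagonalizes hQ
  obtain ⟨W, t, h'', -⟩ := exists_diagonalizes hT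
  rw [relEntropy_eq_of_diagonalizes hP hQ h h'] at hr
  split_ifs at hr with hc
  swap
  · exact absurd hr.symm (EReal.coe_ne_top r)
  rw [EReal.coe_eq_coe_iff] at hr
  rw [relEntropy_eq_of_diagonalizes (posSemidef_kronecker hP hT) (posSemidef_kronecker hQ hT)
    (h.kronecker h'') (h'.kronecker h''), overlap_kronecker_self U V h''.1, if_pos]
  · rw [EReal.coe_eq_coe_iff, ← hr, h''.trace_eq, ← mul_div_assoc]
    congr 1
    simp only [Fintype.sum_prod_type, Matrix.kroneckerMap_apply, Matrix.one_apply]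
    rw [Finset.sum_comm, Finset.sum_mul]
    refine Finset.sum_congr rfl fun k _ => ?_
    rw [Finset.mul_sum]
    refine Finset.sum_congr rfl fun i _ => ?_
    rw [Finset.mul_sum]
    refine Finset.sum_congr rfl fun j _ => ?_
    rw [Finset.sum_eq_single k (fun l _ hl => by simp [hl]) (by simp), if_pos rfl, mul_one]
    -- In the degenerate cases both sides are zero. Otherwise the kernel condition makes `q j`
    -- nonzero, both logarithms split, and `log (t k)` cancels.
    by_cases ht : t k = 0
    · simp [ht]
    by_cases hp : p i = 0
    · simp [hp]
    by_cases ho : overlap U V j i = 0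
    · simp [ho]
    have hq : q j ≠ 0 := fun hq => (hc i j hq).elim hp ho
    rw [Real.log_mul hp ht, Real.log_mul hq ht]
    ring
  · rintro ⟨i, k⟩ ⟨j, l⟩ hz
    simp only [Matrix.kroneckerMap_apply, Matrix.one_apply] at hz ⊢
    by_cases hl : l = k
    · subst hl
      rcases mul_eq_zero.mp hz with hq | ht
      · rcases hc i j hq with hp | ho
        · simp [hp]
        · simp [ho]
      · simp [ht]
    · simp [hl]

/-- The value `⊥` must be excluded because `⊤ + ⊥ = ⊥` in `EReal`. -/
theorem sum_eq_top {ι : Type} {S : Finset ι} {f : ι → EReal} (hf : ∀ i, f i ≠ ⊥)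
    {a : ι} (ha : a ∈ S) (hfa : f a = ⊤) : ∑ i ∈ S, f i = ⊤ := by
  classical
  have hb : ∀ R : Finset ι, ∑ i ∈ R, f i ≠ ⊥ := by
    intro R
    induction R using Finset.induction_on with
    | empty => simp
    | insert b R hb ih =>
      rw [Finset.sum_insert hb]
      exact EReal.add_ne_bot_iff.mpr ⟨hf b, ih⟩
  rw [← Finset.add_sum_erase _ _ ha, hfa, EReal.top_add_of_ne_bot (hb _)]

theorem ereal_coe_sum {ι : Type} (S : Finset ι) (f : ι → ℝ) :
    ((∑ i ∈ S, f i : ℝ) : EReal) = ∑ i ∈ S, (f i : EReal) := by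
  classical
  induction S using Finset.induction_on with
  | empty => simp
  | insert b R hb ih => rw [Finset.sum_insert hb, Finset.sum_insert hb, EReal.coe_add, ih]

/-- Data processing: measuring `(𝒩 ⊗ id)(ρ)` jointly with an ancilla, with POVM elements
`∑ x, |x⟩⟨x| ⊗ T z x`, does not increase the measurement relative entropy. -/
theorem measRelEntropy_kronecker_le [Nonempty n] [Nonempty m] {X Z : Type} [Fintype X] [Fintype Z]
    {N F : X → Matrix n n ℂ} (hN : ∀ x, (N x).PosSemidef) (hF : ∀ x, (F x).PosSemidef)
    {T : Z → X → Matrix m m ℂ} (hT : ∀ z x, (T z x).PosSemidef) (hT1 : ∀ x, ∑ z, T z x = 1) :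
    measRelEntropy (fun z => ∑ x, N x ⊗ₖ T z x) (fun z => ∑ x, F x ⊗ₖ T z x) ≤
      measRelEntropy N F := by
  by_cases htop : ∃ x, relEntropy (N x) (F x) = ⊤
  · obtain ⟨x, hx⟩ := htop
    have : measRelEntropy N F = ⊤ := by
      rw [measRelEntropy, sum_eq_top (fun i => relEntropy_ne_bot (N i) (F i))
        (Finset.mem_univ x) hx]
      exact EReal.coe_mul_top_of_pos (by positivity)
    rw [this]
    exact le_top
  push Not at htop
  -- All terms are now finite, so the rest of the computation takes place in `ℝ`.
  have hr : ∀ x, ∃ r : ℝ, relEntropy (N x) (F x) = r := fun x =>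
    ⟨_, (EReal.coe_toReal (htop x) (relEntropy_ne_bot _ _)).symm⟩
  choose r hr using hr
  have hz : ∀ z, relEntropy (∑ x, N x ⊗ₖ T z x) (∑ x, F x ⊗ₖ T z x) ≤
      ((∑ x, (T z x).trace.re * r x : ℝ) : EReal) := by
    intro z
    refine (relEntropy_sum_le _ (fun x => posSemidef_kronecker (hN x) (hT z x))
      (fun x => posSemidef_kronecker (hF x) (hT z x))).trans ?_
    rw [ereal_coe_sum]
    exact Finset.sum_le_sum fun x _ =>
      (relEntropy_kronecker (hN x) (hF x) (hT z x) (hr x)).le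
  unfold measRelEntropy
  have hc : (0 : EReal) ≤ (((Fintype.card (n × m) : ℝ)⁻¹ : ℝ) : EReal) := by
    exact_mod_cast inv_nonneg.mpr (Nat.cast_nonneg _)
  refine (mul_le_mul_of_nonneg_left (Finset.sum_le_sum fun z _ => hz z) hc).trans ?_
  simp only [hr]
  rw [← ereal_coe_sum, ← ereal_coe_sum, ← EReal.coe_mul, ← EReal.coe_mul, EReal.coe_le_coe_iff]
  -- The total trace equals the ancilla dimension, which cancels against the normalization of `D_m`
  -- on the product system.
  have htr : ∀ x, ∑ z, (T z x).trace.re = Fintype.card m := by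
    intro x
    rw [← Complex.re_sum, ← Matrix.trace_sum, hT1 x, Matrix.trace_one]
    simp
  rw [Finset.sum_comm]
  simp only [← Finset.sum_mul, htr]
  rw [← Finset.mul_sum, Fintype.card_prod]
  push_cast
  refine le_of_eq ?_
  field_simp

end DataProcessing

/-! ### Tensor products of maps and measure-and-prepare channels -/

section Maps

variable {A B A' B' : Type} [Fintype A] [DecidableEq A] [Fintype B] [DecidableEq B]

theorem linearMap_ext_kronecker {V : Type} [AddCommMonoid V] [Module ℂ V]
    {f g : Matrix (A × B) (A × B) ℂ →ₗ[ℂ] V}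
    (h : ∀ (P : Matrix A A ℂ) (Q : Matrix B B ℂ), f (P ⊗ₖ Q) = g (P ⊗ₖ Q)) : f = g := by
  refine Matrix.ext_linearMap ℂ fun i j => LinearMap.ext_ring ?_
  have := h (Matrix.single i.1 j.1 1) (Matrix.single i.2 j.2 1)
  rw [Matrix.single_kronecker_single, mul_one] at this
  exact this

theorem tensorMap_add_left (Φ Φ' : SuperOp A A') (Ψ : SuperOp B B') :
    tensorMap (Φ + Φ') Ψ = tensorMap Φ Ψ + tensorMap Φ' Ψ :=
  linearMap_ext_kronecker fun P Q => by
    simp only [LinearMap.add_apply, tensorMap_kronecker, Matrix.add_kronecker]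

theorem tensorMap_add_right (Φ : SuperOp A A') (Ψ Ψ' : SuperOp B B') :
    tensorMap Φ (Ψ + Ψ') = tensorMap Φ Ψ + tensorMap Φ Ψ' :=
  linearMap_ext_kronecker fun P Q => by
    simp only [LinearMap.add_apply, tensorMap_kronecker, Matrix.kronecker_add]

theorem tensorMap_sum_left {S : Type} (R : Finset S) (Φ : S → SuperOp A A') (Ψ : SuperOp B B') :
    tensorMap (∑ s ∈ R, Φ s) Ψ = ∑ s ∈ R, tensorMap (Φ s) Ψ :=
  map_sum (⟨⟨fun Φ => tensorMap Φ Ψ, linearMap_ext_kronecker fun P Q => by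
    simp [tensorMap_kronecker]⟩, fun _ _ => tensorMap_add_left _ _ _⟩ :
      SuperOp A A' →+ SuperOp (A × B) (A' × B')) Φ R

theorem tensorMap_sum_right {S : Type} (R : Finset S) (Φ : SuperOp A A') (Ψ : S → SuperOp B B') :
    tensorMap Φ (∑ s ∈ R, Ψ s) = ∑ s ∈ R, tensorMap Φ (Ψ s) :=
  map_sum (⟨⟨fun Ψ => tensorMap Φ Ψ, linearMap_ext_kronecker fun P Q => by
    simp [tensorMap_kronecker]⟩, fun _ _ => tensorMap_add_right _ _ _⟩ :
      SuperOp B B' →+ SuperOp (A × B) (A' × B')) Ψ R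

/-- The map `ρ ↦ tr (E ρ) σ`. -/
noncomputable def effectPrepare (E : Matrix A A ℂ) (σ : Matrix A' A' ℂ) : SuperOp A A' :=
  (Matrix.traceLinearMap A ℂ ℂ ∘ₗ LinearMap.mulLeft ℂ E).smulRight σ

theorem effectPrepare_apply (E : Matrix A A ℂ) (σ : Matrix A' A' ℂ) (ρ : Matrix A A ℂ) :
    effectPrepare E σ ρ = (E * ρ).trace • σ := rfl

theorem tensorMap_effectPrepare (E : Matrix A A ℂ) (σ : Matrix A' A' ℂ) (F : Matrix B B ℂ)
    (τ : Matrix B' B' ℂ) :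
    tensorMap (effectPrepare E σ) (effectPrepare F τ) = effectPrepare (E ⊗ₖ F) (σ ⊗ₖ τ) :=
  linearMap_ext_kronecker fun P Q => by
    simp only [tensorMap_kronecker, effectPrepare_apply, ← Matrix.mul_kronecker_mul,
      Matrix.trace_kronecker, Matrix.smul_kronecker, Matrix.kronecker_smul, smul_smul]
    rw [mul_comm]

/-- The contraction `tr_A ((E ⊗ 1) X)`. -/
noncomputable def partialContract (E : Matrix A A ℂ) (X : Matrix (A × B) (A × B) ℂ) :
    Matrix B B ℂ :=
  Matrix.of fun k l => ∑ i, ∑ j, E j i * X (i, k) (j, l)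

/-- With `E = ∑ a, p a |u_a⟩⟨u_a|` and `D a = ⟨u_a| ⊗ 1`, the contraction is `∑ a, p a • D a X (D
a)ᴴ`, a nonnegative combination of congruences of `X`. -/
theorem posSemidef_partialContract {E : Matrix A A ℂ} (hE : E.PosSemidef)
    {X : Matrix (A × B) (A × B) ℂ} (hX : X.PosSemidef) : (partialContract E X).PosSemidef := by
  obtain ⟨U, p, h, hp⟩ := exists_diagonalizes hE
  let D : A → Matrix B (A × B) ℂ := fun a =>
    Matrix.of fun k ik => if k = ik.2 then star (U ik.1 a) else 0
  have key : partialContract E X = ∑ a, (p a : ℂ) • (D a * X * (D a).conjTranspose) := by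
    ext k l
    have hD : ∀ a, (D a * X * (D a).conjTranspose) k l =
        ∑ i, ∑ j, U j a * star (U i a) * X (i, k) (j, l) := by
      intro a
      simp only [Matrix.mul_apply, Matrix.conjTranspose_apply, D, Matrix.of_apply,
        Fintype.sum_prod_type, ite_mul, zero_mul, apply_ite star, star_star, star_zero, mul_ite,
        mul_zero, Finset.sum_ite_eq, Finset.mem_univ, if_true, Finset.sum_mul]
      rw [Finset.sum_comm]
      exact Finset.sum_congr rfl fun _ _ => Finset.sum_congr rfl fun _ _ => by ring
    have hEe : ∀ i j, E j i = ∑ a, (p a : ℂ) * (U j a * star (U i a)) := by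
      intro i j
      rw [h.2, Matrix.mul_apply]
      simp only [Matrix.mul_diagonal, Matrix.conjTranspose_apply]
      exact Finset.sum_congr rfl fun _ _ => by ring
    simp only [Matrix.sum_apply, Matrix.smul_apply, hD, partialContract, Matrix.of_apply, hEe,
      smul_eq_mul, Finset.sum_mul, Finset.mul_sum]
    rw [Finset.sum_comm' (t' := Finset.univ) (s' := fun _ => Finset.univ) (by simp)]
    refine Eq.trans ?_ Finset.sum_comm
    refine Eq.trans Finset.sum_comm ?_
    refine Finset.sum_congr rfl fun i _ => ?_
    refine Eq.trans Finset.sum_comm ?_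
    exact Finset.sum_congr rfl fun _ _ => Finset.sum_congr rfl fun _ _ => by ring
  rw [key]
  refine Matrix.posSemidef_sum _ fun a _ => ?_
  exact (hX.mul_mul_conjTranspose_same (D a)).smul (by exact_mod_cast hp a)

theorem tensorMap_effectPrepare_id (E : Matrix A A ℂ) (σ : Matrix A' A' ℂ)
    (X : Matrix (A × B) (A × B) ℂ) :
    tensorMap (effectPrepare E σ) (LinearMap.id : SuperOp B B) X = σ ⊗ₖ partialContract E X := by
  ext ⟨a, k⟩ ⟨b, l⟩
  simp only [tensorMap, LinearMap.coe_mk, AddHom.coe_mk, Matrix.sum_apply, Matrix.smul_apply,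
    Matrix.kroneckerMap_apply, effectPrepare_apply, smul_eq_mul, LinearMap.id_apply,
    partialContract, Matrix.of_apply, Finset.mul_sum, Matrix.trace_mul_single]
  refine Finset.sum_congr rfl fun i _ => Finset.sum_congr rfl fun j _ => ?_
  rw [Finset.sum_eq_single k, Finset.sum_eq_single l]
  · simp; ring
  · intro d _ hd; simp [hd]
  · simp
  · intro d _ hd
    exact Finset.sum_eq_zero fun _ _ => by simp [hd]
  · simp

variable [Fintype A'] [DecidableEq A'] [Fintype B'] [DecidableEq B']

theorem isCP_effectPrepare {E : Matrix A A ℂ} {σ : Matrix A' A' ℂ} (hE : E.PosSemidef)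
    (hσ : σ.PosSemidef) : IsCP (effectPrepare E σ) := by
  intro K _ _ X hX
  rw [tensorMap_effectPrepare_id]
  exact posSemidef_kronecker hσ (posSemidef_partialContract hE hX)

omit [Fintype A'] [DecidableEq A'] in
theorem isCP_sum {S : Type} [Fintype S] {Φ : S → SuperOp A A'} (h : ∀ s, IsCP (Φ s)) :
    IsCP (∑ s, Φ s) := by
  intro K _ _ X hX
  rw [tensorMap_sum_left, LinearMap.sum_apply]
  exact Matrix.posSemidef_sum _ fun s _ => h s K X hX

theorem isChannel_measurePrepare {S : Type} [Fintype S] {M : S → Matrix A A ℂ}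
    {σ : S → Matrix A' A' ℂ} (hM : IsPOVM M) (hσ : ∀ s, (σ s).PosSemidef)
    (hσ1 : ∀ s, (σ s).trace = 1) : IsChannel (∑ s, effectPrepare (M s) (σ s)) := by
  refine ⟨isCP_sum fun s => isCP_effectPrepare (hM.1 s) (hσ s), fun X => ?_⟩
  simp only [LinearMap.sum_apply, effectPrepare_apply, Matrix.trace_sum, Matrix.trace_smul, hσ1,
    smul_eq_mul, mul_one]
  rw [← Matrix.trace_sum, ← Finset.sum_mul, hM.2, Matrix.one_mul]

omit [Fintype A] in
theorem posSemidef_single (a : A) : (Matrix.single a a (1 : ℂ)).PosSemidef := by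
  rw [← Matrix.diagonal_single]
  refine Matrix.PosSemidef.diagonal fun i => ?_
  by_cases h : i = a
  · subst h; simp
  · simp [h]

theorem isPOVM_single : IsPOVM fun a : A => Matrix.single a a (1 : ℂ) :=
  ⟨posSemidef_single, by
    ext i j
    simp [Matrix.sum_apply, Matrix.single_apply, Matrix.one_apply, ite_and]⟩

theorem isPOVM_kronecker {X Y : Type} [Fintype X] [Fintype Y] {P : X → Matrix A A ℂ}
    {Q : Y → Matrix B B ℂ} (hP : IsPOVM P) (hQ : IsPOVM Q) :
    IsPOVM fun z : X × Y => P z.1 ⊗ₖ Q z.2 := by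
  refine ⟨fun z => posSemidef_kronecker (hP.1 _) (hQ.1 _), ?_⟩
  rw [← Matrix.one_kronecker_one, ← hP.2, ← hQ.2]
  ext ⟨a, b⟩ ⟨c, d⟩
  simp only [Matrix.sum_apply, Matrix.kroneckerMap_apply, Fintype.sum_prod_type, Finset.sum_mul_sum]

theorem measChannel_eq_sum {X : Type} [Fintype X] [DecidableEq X] (M : X → Matrix A A ℂ) :
    measChannel M = ∑ x, effectPrepare (M x) (Matrix.single x x 1) := by
  refine LinearMap.ext fun ρ => ?_
  ext i j
  simp only [measChannel, LinearMap.coe_mk, AddHom.coe_mk, LinearMap.sum_apply,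
    effectPrepare_apply, Matrix.sum_apply, Matrix.smul_apply, Matrix.single_apply, smul_eq_mul,
    Matrix.diagonal_apply, ite_and]
  simp

theorem isChannel_measChannel {X : Type} [Fintype X] [DecidableEq X] {M : X → Matrix A A ℂ}
    (hM : IsPOVM M) : IsChannel (measChannel M) := by
  rw [measChannel_eq_sum]
  exact isChannel_measurePrepare hM posSemidef_single (by simp)

theorem dephase_apply (X : Matrix A A ℂ) : dephase A X = Matrix.diagonal X.diag := rfl

theorem isDIO_measChannel {X : Type} [Fintype X] [DecidableEq X] {M : X → Matrix A A ℂ}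
    (hM : IsIncoherentMeas M) : IsDIO (measChannel M) := by
  refine ⟨isChannel_measChannel hM.1, LinearMap.ext fun ρ => ?_⟩
  -- A diagonal element pairs only with the diagonal of `ρ`.
  have h : ∀ x, (M x * ρ).trace = (M x * dephase A ρ).trace := by
    intro x
    rw [← hM.2 x, dephase_apply, dephase_apply]
    simp [Matrix.trace]
  simp only [LinearMap.comp_apply, measChannel, LinearMap.coe_mk, AddHom.coe_mk, h]

end Maps

/-! ### Measurements pulled back along channels -/

section Preprocess

variable {A B A' B' : Type} [Fintype A] [DecidableEq A] [Fintype B] [DecidableEq B]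
  [Fintype A'] [DecidableEq A'] [Fintype B'] [DecidableEq B'] {Z : Type}

omit [DecidableEq A'] in
theorem trace_preprocess_mul (M : Z → Matrix A' A' ℂ) (E : SuperOp A A') (z : Z)
    (ρ : Matrix A A ℂ) : (preprocess M E z * ρ).trace = (M z * E ρ).trace := by
  have : Matrix.traceLinearMap A ℂ ℂ ∘ₗ LinearMap.mulLeft ℂ (preprocess M E z) =
      Matrix.traceLinearMap A' ℂ ℂ ∘ₗ LinearMap.mulLeft ℂ (M z) ∘ₗ E := by
    refine Matrix.ext_linearMap ℂ fun i j => LinearMap.ext_ring ?_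
    simp [preprocess, Matrix.trace_mul_single]
  exact LinearMap.congr_fun this ρ

omit [DecidableEq A'] in
/-- `preprocess M E z` is determined by the adjoint relation. -/
theorem eq_preprocess {M : Z → Matrix A' A' ℂ} {E : SuperOp A A'} {z : Z} {R : Matrix A A ℂ}
    (h : ∀ ρ, (R * ρ).trace = (M z * E ρ).trace) : preprocess M E z = R := by
  ext i j
  have := h (Matrix.single j i 1)
  rw [Matrix.trace_mul_single] at this
  simpa [preprocess] using this.symm

theorem trace_mul_ext_kronecker {R S : Matrix (A × B) (A × B) ℂ}
    (h : ∀ (P : Matrix A A ℂ) (Q : Matrix B B ℂ),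
      (R * (P ⊗ₖ Q)).trace = (S * (P ⊗ₖ Q)).trace) : R = S := by
  ext i j
  have := h (Matrix.single j.1 i.1 1) (Matrix.single j.2 i.2 1)
  rw [Matrix.single_kronecker_single, Matrix.trace_mul_single, Matrix.trace_mul_single] at this
  simpa using this

/-- Reading the classical register recovers the measurement; this makes the basis measurement the
right test in the lower bounds. -/
theorem preprocess_single_measChannel [Fintype Z] [DecidableEq Z] (N : Z → Matrix A A ℂ) :
    preprocess (fun z => Matrix.single z z (1 : ℂ)) (measChannel N) = N := by
  funext z
  refine eq_preprocess fun ρ => ?_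
  simp [measChannel, Matrix.trace_single_mul]

omit [DecidableEq A'] in
/-- Preprocessing a product measurement with a local channel on one factor. -/
theorem preprocess_kronecker_one {K : Type} [Fintype K] [DecidableEq K] (M : Z → Matrix A' A' ℂ)
    (E : SuperOp A A') (z : Z) :
    preprocess (fun z => M z ⊗ₖ (1 : Matrix K K ℂ)) (tensorMap E (LinearMap.id : SuperOp K K)) z =
      preprocess M E z ⊗ₖ (1 : Matrix K K ℂ) :=
  trace_mul_ext_kronecker fun P Q => by
    rw [trace_preprocess_mul, tensorMap_kronecker, ← Matrix.mul_kronecker_mul,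
      ← Matrix.mul_kronecker_mul, Matrix.trace_kronecker, Matrix.trace_kronecker,
      trace_preprocess_mul]
    rfl

/-- Measuring `N` on the system, keeping the ancilla, and then measuring `M` jointly. -/
theorem preprocess_tensorMap_measChannel {K X : Type} [Fintype K] [DecidableEq K] [Fintype X]
    [DecidableEq X] (M : Z → Matrix (X × K) (X × K) ℂ) (N : X → Matrix A A ℂ) (z : Z) :
    preprocess M (tensorMap (measChannel N) (LinearMap.id : SuperOp K K)) z =
      ∑ x, N x ⊗ₖ (M z).submatrix (fun k => (x, k)) (fun k => (x, k)) :=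
  trace_mul_ext_kronecker fun P Q => by
    rw [trace_preprocess_mul, tensorMap_kronecker, Finset.sum_mul, Matrix.trace_sum]
    simp only [← Matrix.mul_kronecker_mul, Matrix.trace_kronecker, LinearMap.id_apply, measChannel,
      LinearMap.coe_mk, AddHom.coe_mk]
    conv_lhs => rw [Matrix.trace]
    rw [Fintype.sum_prod_type]
    refine Finset.sum_congr rfl fun x _ => ?_
    rw [Matrix.trace, Matrix.trace, Finset.mul_sum]
    refine Finset.sum_congr rfl fun k _ => ?_
    simp only [Matrix.diag_apply, Matrix.mul_apply, Fintype.sum_prod_type,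
      Matrix.kroneckerMap_apply, Matrix.submatrix_apply, Matrix.diagonal_apply]
    -- The register is diagonal, so only the `(x, x)` block of `M z` contributes.
    rw [Finset.sum_eq_single x (fun y _ hy => by simp [hy]) (by simp), Finset.mul_sum]
    refine Finset.sum_congr rfl fun l _ => ?_
    simp only [if_true, Matrix.trace, Matrix.diag_apply, Matrix.mul_apply]
    ring

theorem trace_mul_submatrix_equiv {m n : Type} [Fintype m] [Fintype n] (e : m ≃ n)
    (M : Matrix m m ℂ) (R : Matrix n n ℂ) :
    (M * R.submatrix e e).trace = (M.submatrix e.symm e.symm * R).trace := by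
  have : M = (M.submatrix e.symm e.symm).submatrix e e := by simp
  conv_lhs => rw [this, Matrix.submatrix_mul_equiv]
  simp only [Matrix.trace, Matrix.diag_apply, Matrix.submatrix_apply]
  exact e.sum_comp fun i => (M.submatrix e.symm e.symm * R) i i

-- Regrouping the subsystems only permutes basis vectors, and `relEntropy` is invariant under this.
-- The bipartite case thereby reduces to the data processing inequality for a single system with
-- ancilla `K × L`.
omit [DecidableEq A'] [DecidableEq B'] in
theorem preprocess_extendBipartite {K L : Type} [Fintype K] [DecidableEq K] [Fintype L]
    [DecidableEq L] (M : Z → Matrix ((A' × K) × (B' × L)) ((A' × K) × (B' × L)) ℂ)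
    (E : SuperOp (A × B) (A' × B')) (z : Z) :
    preprocess M (extendBipartite K L E) z =
      (preprocess (fun z => (M z).submatrix (Equiv.prodProdProdComm A' B' K L)
        (Equiv.prodProdProdComm A' B' K L))
        (tensorMap E (LinearMap.id : SuperOp (K × L) (K × L))) z).submatrix
          (Equiv.prodProdProdComm A K B L) (Equiv.prodProdProdComm A K B L) := by
  refine eq_preprocess fun ρ => ?_
  simp only [extendBipartite, LinearMap.comp_apply, LinearEquiv.coe_coe,
    Matrix.coe_reindexLinearEquiv, Matrix.reindex_apply]
  rw [trace_mul_submatrix_equiv, Equiv.symm_symm]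
  have h := trace_preprocess_mul (fun z => (M z).submatrix (Equiv.prodProdProdComm A' B' K L)
        (Equiv.prodProdProdComm A' B' K L))
        (tensorMap E (LinearMap.id : SuperOp (K × L) (K × L))) z
        (ρ.submatrix (Equiv.prodProdProdComm A K B L).symm (Equiv.prodProdProdComm A K B L).symm)
  rw [← h, trace_mul_submatrix_equiv, Equiv.symm_symm]

/-- Over `ℂ` a real quadratic form already forces the matrix to be Hermitian. -/
theorem posSemidef_of_quadForm_nonneg {R : Matrix A A ℂ}
    (h : ∀ v : A → ℂ, 0 ≤ star v ⬝ᵥ R.mulVec v) : R.PosSemidef := by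
  rw [← Matrix.isPositive_toEuclideanLin_iff, LinearMap.isPositive_iff_complex]
  intro x
  have h1 : inner ℂ (Matrix.toEuclideanLin R x) x = star (star x.ofLp ⬝ᵥ R.mulVec x.ofLp) := by
    rw [EuclideanSpace.inner_eq_star_dotProduct, Matrix.star_dotProduct, star_star,
      dotProduct_comm]
    rfl
  have h2 := Complex.nonneg_iff.mp (h x.ofLp)
  rw [h1]
  refine ⟨Complex.ext ?_ ?_, ?_⟩
  · simp
  · simp [← h2.2]
  · simpa using h2.1

theorem trace_mul_nonneg {P Q : Matrix A A ℂ} (hP : P.PosSemidef) (hQ : Q.PosSemidef) :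
    0 ≤ (P * Q).trace := by
  -- With a one-dimensional remaining factor the contraction is the scalar `tr (P Q)`.
  have h := posSemidef_partialContract (B := Unit) hP
    (posSemidef_kronecker hQ (Matrix.PosSemidef.one (n := Unit)))
  have h2 := h.diag_nonneg (i := ())
  refine h2.trans_eq ?_
  simp only [partialContract, Matrix.of_apply, Matrix.kroneckerMap_apply, Matrix.one_apply_eq,
    mul_one, Matrix.trace, Matrix.diag_apply, Matrix.mul_apply]
  exact Finset.sum_comm

/-- The adjoint of a positive trace-preserving map turns measurements into measurements. -/
theorem isPOVM_preprocess [Fintype Z] {M : Z → Matrix A' A' ℂ} {E : SuperOp A A'} (hM : IsPOVM M)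
    (hE : ∀ ρ : Matrix A A ℂ, ρ.PosSemidef → (E ρ).PosSemidef)
    (hE1 : ∀ ρ : Matrix A A ℂ, (E ρ).trace = ρ.trace) : IsPOVM (preprocess M E) := by
  constructor
  · intro z
    refine posSemidef_of_quadForm_nonneg fun v => ?_
    have h1 : star v ⬝ᵥ (preprocess M E z).mulVec v =
        (preprocess M E z * Matrix.vecMulVec v (star v)).trace := by
      rw [Matrix.mul_vecMulVec, Matrix.trace_vecMulVec, dotProduct_comm]
    rw [h1, trace_preprocess_mul]
    exact trace_mul_nonneg (hM.1 z) (hE _ (Matrix.posSemidef_vecMulVec_self_star v))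
  · ext i j
    rw [Matrix.sum_apply]
    simp only [preprocess, Matrix.of_apply]
    rw [← Matrix.trace_sum, ← Finset.sum_mul, hM.2, Matrix.one_mul, hE1,
      Matrix.trace, Matrix.one_apply]
    simp [Matrix.single_apply, ite_and]

/-- Needed so that limits of LOCC measurements are still measurements. -/
theorem isClosed_isPOVM [Fintype Z] : IsClosed {M : Z → Matrix A A ℂ | IsPOVM M} := by
  have h : {M : Z → Matrix A A ℂ | IsPOVM M} =
      (⋂ z, ⋂ v : A → ℂ, {M | 0 ≤ star v ⬝ᵥ (M z).mulVec v}) ∩ {M | ∑ z, M z = 1} := by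
    ext M
    simp only [IsPOVM, Set.mem_ofPred_eq, Set.mem_inter_iff, Set.mem_iInter]
    exact and_congr_left fun _ => forall_congr' fun z =>
      ⟨fun hz => hz.dotProduct_mulVec_nonneg, posSemidef_of_quadForm_nonneg⟩
  rw [h]
  refine IsClosed.inter (isClosed_iInter fun z => isClosed_iInter fun v => ?_) ?_
  · exact isClosed_le continuous_const (by fun_prop)
  · exact isClosed_eq (by fun_prop) continuous_const

end Preprocess

/-! ### LOCC channels, LOCC measurements and their closures -/

section LOCCProperties

variable {A B A' B' : Type} [Fintype A] [DecidableEq A] [Fintype B] [DecidableEq B]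
  [Fintype A'] [DecidableEq A'] [Fintype B'] [DecidableEq B']

omit [Fintype A'] [DecidableEq A'] in
theorem posSemidef_of_isCP {Φ : SuperOp A A'} (hΦ : IsCP Φ) {ρ : Matrix A A ℂ}
    (hρ : ρ.PosSemidef) : (Φ ρ).PosSemidef := by
  have h := hΦ Unit (ρ ⊗ₖ 1) (posSemidef_kronecker hρ Matrix.PosSemidef.one)
  rw [tensorMap_kronecker] at h
  have h2 := h.submatrix fun a : A' => (a, ())
  convert h2 using 1
  ext i j
  simp

-- `IsCP` places the ancilla on the right, so `Φ ⊗ Ψ` is factored as `Φ ⊗ id` after `Ψ ⊗ id`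
-- conjugated by swaps.
omit [Fintype A'] [DecidableEq A'] in
theorem posSemidef_tensorMap {Φ : SuperOp A A'} {Ψ : SuperOp B B'} (hΦ : IsCP Φ) (hΨ : IsCP Ψ)
    {X : Matrix (A × B) (A × B) ℂ} (hX : X.PosSemidef) : (tensorMap Φ Ψ X).PosSemidef := by
  have h : tensorMap Φ Ψ = tensorMap Φ (LinearMap.id : SuperOp B' B') ∘ₗ
      (Matrix.reindexLinearEquiv ℂ ℂ (Equiv.prodComm B' A) (Equiv.prodComm B' A)).toLinearMap ∘ₗ
      tensorMap Ψ (LinearMap.id : SuperOp A A) ∘ₗ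
      (Matrix.reindexLinearEquiv ℂ ℂ (Equiv.prodComm A B) (Equiv.prodComm A B)).toLinearMap := by
    refine linearMap_ext_kronecker fun P Q => ?_
    have hswap : ∀ {C D : Type} (P : Matrix C C ℂ) (Q : Matrix D D ℂ),
        (P ⊗ₖ Q).submatrix (Equiv.prodComm C D).symm (Equiv.prodComm C D).symm = Q ⊗ₖ P := by
      intro C D P Q
      ext i j
      simp [mul_comm]
    simp only [LinearMap.comp_apply, LinearEquiv.coe_coe, Matrix.coe_reindexLinearEquiv,
      Matrix.reindex_apply, hswap, tensorMap_kronecker, LinearMap.id_apply]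
  rw [h]
  exact hΦ _ _ ((hΨ _ _ (hX.submatrix _)).submatrix _)

/-- Plain positivity suffices for `isPOVM_preprocess` and passes through compositions without
carrying an ancilla. -/
theorem IsLOCC.positive_and_trace {F : SuperOp (A × B) (A' × B')} (hF : IsLOCC F) :
    (∀ ρ : Matrix (A × B) (A × B) ℂ, ρ.PosSemidef → (F ρ).PosSemidef) ∧
      ∀ ρ : Matrix (A × B) (A × B) ℂ, (F ρ).trace = ρ.trace := by
  induction hF with
  | right F h =>
    obtain ⟨S, _, Φ, Ψ, hΦ, hΦ1, hΨ, rfl⟩ := h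
    refine ⟨fun ρ hρ => ?_, ?_⟩
    · rw [LinearMap.sum_apply]
      exact Matrix.posSemidef_sum _ fun s _ => posSemidef_tensorMap (hΦ s) (hΨ s).1 hρ
    · refine LinearMap.congr_fun (f := Matrix.traceLinearMap _ ℂ ℂ ∘ₗ _)
        (g := Matrix.traceLinearMap _ ℂ ℂ) (linearMap_ext_kronecker fun P Q => ?_)
      simp only [LinearMap.comp_apply, LinearMap.sum_apply, tensorMap_kronecker, map_sum,
        Matrix.traceLinearMap_apply, Matrix.trace_kronecker, (hΨ _).2]
      rw [← Finset.sum_mul, ← Matrix.trace_sum, ← LinearMap.sum_apply, hΦ1.2]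
  | left F h =>
    obtain ⟨S, _, Φ, Ψ, hΨ, hΨ1, hΦ, rfl⟩ := h
    refine ⟨fun ρ hρ => ?_, ?_⟩
    · rw [LinearMap.sum_apply]
      exact Matrix.posSemidef_sum _ fun s _ => posSemidef_tensorMap (hΦ s).1 (hΨ s) hρ
    · refine LinearMap.congr_fun (f := Matrix.traceLinearMap _ ℂ ℂ ∘ₗ _)
        (g := Matrix.traceLinearMap _ ℂ ℂ) (linearMap_ext_kronecker fun P Q => ?_)
      simp only [LinearMap.comp_apply, LinearMap.sum_apply, tensorMap_kronecker, map_sum,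
        Matrix.traceLinearMap_apply, Matrix.trace_kronecker, (hΦ _).2]
      rw [← Finset.mul_sum, ← Matrix.trace_sum, ← LinearMap.sum_apply, hΨ1.2]
  | comp G F _ _ hG hF =>
    exact ⟨fun ρ hρ => hG.1 _ (hF.1 _ hρ), fun ρ => (hG.2 _).trans (hF.2 _)⟩

/-- Local measurements on both sides form an LOCC measurement. -/
theorem isLOCCMeas_kronecker {X Y : Type} [Fintype X] [DecidableEq X] [Fintype Y] [DecidableEq Y]
    {P : X → Matrix A A ℂ} {Q : Y → Matrix B B ℂ} (hP : IsPOVM P) (hQ : IsPOVM Q) :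
    IsLOCCMeas fun z : X × Y => P z.1 ⊗ₖ Q z.2 := by
  -- Round one: Alice measures `P` and announces `x`; Bob measures `Q` and records the pair `(x,
  -- y)`.
  have h1 : IsLOCC (∑ x, tensorMap (effectPrepare (P x) (Matrix.single x x (1 : ℂ)))
      (∑ y, effectPrepare (Q y) (Matrix.single (x, y) (x, y) (1 : ℂ)))) :=
    .right _ ⟨X, inferInstance, fun x => effectPrepare (P x) (Matrix.single x x (1 : ℂ)),
      fun x => ∑ y, effectPrepare (Q y) (Matrix.single (x, y) (x, y) (1 : ℂ)),
      fun x => isCP_effectPrepare (hP.1 x) (posSemidef_single x),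
      isChannel_measurePrepare hP posSemidef_single (by simp),
      fun x => isChannel_measurePrepare hQ (fun y => posSemidef_single _) (by simp), rfl⟩
  -- Round two: Bob reads his register and announces the pair; Alice discards `x` and prepares the
  -- pair, so that both hold the full outcome.
  have h2 : IsLOCC (∑ z : X × Y,
      tensorMap (effectPrepare (1 : Matrix X X ℂ) (Matrix.single z z (1 : ℂ)))
      (effectPrepare (Matrix.single z z (1 : ℂ)) (Matrix.single z z (1 : ℂ)))) := by
    refine .left _ ⟨X × Y, inferInstance,
      fun z => effectPrepare (1 : Matrix X X ℂ) (Matrix.single z z (1 : ℂ)),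
      fun z => effectPrepare (Matrix.single z z (1 : ℂ)) (Matrix.single z z (1 : ℂ)),
      fun z => isCP_effectPrepare (posSemidef_single z) (posSemidef_single z),
      isChannel_measurePrepare isPOVM_single posSemidef_single (by simp), fun z => ?_, rfl⟩
    have := isChannel_measurePrepare (S := Unit) (M := fun _ => (1 : Matrix X X ℂ))
      (σ := fun _ => Matrix.single z z (1 : ℂ)) ⟨fun _ => Matrix.PosSemidef.one, by simp⟩
      (fun _ => posSemidef_single z) (by simp)
    simpa using this
  refine ⟨isPOVM_kronecker hP hQ, _, h2.comp _ _ h1, fun ρ => ?_⟩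
  simp only [tensorMap_sum_right, tensorMap_effectPrepare, LinearMap.comp_apply,
    LinearMap.sum_apply, effectPrepare_apply]
  refine Finset.sum_congr rfl fun z _ => ?_
  congr 1
  simp only [Finset.mul_sum, Matrix.trace_sum, Matrix.mul_smul, Matrix.trace_smul, smul_eq_mul,
    ← Matrix.mul_kronecker_mul, Matrix.trace_kronecker, Matrix.one_mul, Matrix.trace_single_mul,
    Matrix.trace_single_eq_same, Matrix.single_apply]
  rw [← Fintype.sum_prod_type' (f := fun x y => (P x ⊗ₖ Q y * ρ).trace *
    (1 * (1 * if (x, y) = z ∧ (x, y) = z then (1 : ℂ) else 0)))]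
  simp

/-- Discarding the copies of the outcome turns an LOCC measurement into an LOCC channel. -/
theorem isLOCC_measChannel {X Y : Type} [Fintype X] [DecidableEq X] [Fintype Y] [DecidableEq Y]
    {M : X × Y → Matrix (A × B) (A × B) ℂ} (hM : IsLOCCMeas M) : IsLOCC (measChannel M) := by
  obtain ⟨-, G, hG, hGM⟩ := hM
  -- Alice keeps the first component and Bob the second: a product of local channels, hence one-way
  -- LOCC with a trivial message.
  have h1 : IsLOCC (tensorMap
      (∑ z : X × Y, effectPrepare (Matrix.single z z (1 : ℂ)) (Matrix.single z.1 z.1 (1 : ℂ)))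
      (∑ z : X × Y, effectPrepare (Matrix.single z z (1 : ℂ)) (Matrix.single z.2 z.2 (1 : ℂ)))) := by
    have hA : IsChannel (∑ z : X × Y,
        effectPrepare (Matrix.single z z (1 : ℂ)) (Matrix.single z.1 z.1 (1 : ℂ))) :=
      isChannel_measurePrepare isPOVM_single (fun z => posSemidef_single _) (by simp)
    have hB : IsChannel (∑ z : X × Y,
        effectPrepare (Matrix.single z z (1 : ℂ)) (Matrix.single z.2 z.2 (1 : ℂ))) :=
      isChannel_measurePrepare isPOVM_single (fun z => posSemidef_single _) (by simp)
    exact .right _ ⟨Unit, inferInstance, fun _ => _, fun _ => _, fun _ => hA.1,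
      by simpa using hA, fun _ => hB, by simp⟩
  have h2 : measChannel M = tensorMap
      (∑ z : X × Y, effectPrepare (Matrix.single z z (1 : ℂ)) (Matrix.single z.1 z.1 (1 : ℂ)))
      (∑ z : X × Y, effectPrepare (Matrix.single z z (1 : ℂ)) (Matrix.single z.2 z.2 (1 : ℂ))) ∘ₗ
      G := by
    refine LinearMap.ext fun ρ => ?_
    have hz : ∀ {C : Type} [Fintype C] [DecidableEq C] (f : X × Y → C) (w : X × Y),
        (∑ z : X × Y, effectPrepare (Matrix.single z z (1 : ℂ))
          (Matrix.single (f z) (f z) (1 : ℂ))) (Matrix.single w w 1) =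
        Matrix.single (f w) (f w) 1 := by
      intro C _ _ f w
      simp only [LinearMap.sum_apply, effectPrepare_apply, Matrix.trace_single_mul]
      rw [Finset.sum_eq_single w (fun z _ hz => by simp [hz.symm]) (by simp)]
      simp
    rw [LinearMap.comp_apply, hGM, map_sum, measChannel_eq_sum, LinearMap.sum_apply]
    refine Finset.sum_congr rfl fun w _ => ?_
    rw [map_smul, tensorMap_kronecker, hz Prod.fst, hz Prod.snd, Matrix.single_kronecker_single,
      mul_one, effectPrepare_apply]
  rw [h2]
  exact h1.comp _ _ hG

theorem isLOCCMeas_preprocess {Z : Type} [Fintype Z] [DecidableEq Z]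
    {M : Z → Matrix (A' × B') (A' × B') ℂ} (hM : IsLOCCMeas M) {F : SuperOp (A × B) (A' × B')}
    (hF : IsLOCC F) : IsLOCCMeas (preprocess M F) := by
  obtain ⟨hM1, G, hG, hGM⟩ := hM
  refine ⟨isPOVM_preprocess hM1 hF.positive_and_trace.1 hF.positive_and_trace.2, G ∘ₗ F,
    hG.comp _ _ hF, fun ρ => ?_⟩
  rw [LinearMap.comp_apply, hGM]
  simp only [trace_preprocess_mul]

theorem IsClosedLOCCMeas.isPOVM {Z : Type} [Fintype Z] [DecidableEq Z]
    {M : Z → Matrix (A × B) (A × B) ℂ} (hM : IsClosedLOCCMeas M) : IsPOVM M :=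
  closure_minimal (fun _ h => h.1) isClosed_isPOVM hM

/-- The map `M ↦ measChannel M` is continuous and sends LOCC measurements to LOCC channels, so it
respects closures. -/
theorem isClosedLOCC_measChannel {X Y : Type} [Fintype X] [DecidableEq X] [Fintype Y]
    [DecidableEq Y] {M : X × Y → Matrix (A × B) (A × B) ℂ} (hM : IsClosedLOCCMeas M) :
    IsClosedLOCC (measChannel M) := by
  refine map_mem_closure (f := fun M : X × Y → Matrix (A × B) (A × B) ℂ =>
    (⇑(measChannel M) : Matrix (A × B) (A × B) ℂ → Matrix (X × Y) (X × Y) ℂ)) ?_ hM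
    fun M hM => ⟨_, isLOCC_measChannel hM, rfl⟩
  refine continuous_pi fun ρ => ?_
  change Continuous fun M : X × Y → Matrix (A × B) (A × B) ℂ =>
    Matrix.diagonal fun x => (M x * ρ).trace
  fun_prop

theorem isClosedLOCCMeas_preprocess {Z : Type} [Fintype Z] [DecidableEq Z]
    {M : Z → Matrix (A' × B') (A' × B') ℂ} (hM : IsLOCCMeas M) {F : SuperOp (A × B) (A' × B')}
    (hF : IsClosedLOCC F) : IsClosedLOCCMeas (preprocess M F) := by
  -- `preprocess M` is unfolded to act on arbitrary functions, since the closure in `IsClosedLOCC`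
  -- is taken in the function space. `M` is fixed and only the channel varies.
  have hc : Continuous fun (f : Matrix (A × B) (A × B) ℂ → Matrix (A' × B') (A' × B') ℂ) (z : Z) =>
      (Matrix.of fun i j => (M z * f (Matrix.single j i 1)).trace :
        Matrix (A × B) (A × B) ℂ) := by
    refine continuous_pi fun z => continuous_matrix fun i j => ?_
    simp only [Matrix.of_apply]
    fun_prop
  refine map_mem_closure (f := fun (f : Matrix (A × B) (A × B) ℂ → Matrix (A' × B') (A' × B') ℂ)
    (z : Z) => (Matrix.of fun i j => (M z * f (Matrix.single j i 1)).trace :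
      Matrix (A × B) (A × B) ℂ)) hc hF ?_
  rintro f ⟨G, hG, rfl⟩
  exact isLOCCMeas_preprocess hM hG

end LOCCProperties

/-! ### Equality of powers and static measures -/

section Powers

variable {A B X Y : Type} [Fintype A] [DecidableEq A] [Fintype B] [DecidableEq B] [Fintype X]
  [DecidableEq X] [Fintype Y] [DecidableEq Y]

theorem isIncoherentMeas_single_kronecker_one {K : Type} [Fintype K] [DecidableEq K] :
    IsIncoherentMeas fun x : X => Matrix.single x x (1 : ℂ) ⊗ₖ (1 : Matrix K K ℂ) := by
  refine ⟨⟨fun x => posSemidef_kronecker (posSemidef_single x) Matrix.PosSemidef.one, ?_⟩,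
    fun x => ?_⟩
  · rw [← Matrix.one_kronecker_one, ← (isPOVM_single (A := X)).2]
    ext ⟨a, b⟩ ⟨c, d⟩
    simp only [Matrix.sum_apply, Matrix.kroneckerMap_apply, Finset.sum_mul]
  · beta_reduce
    rw [← Matrix.diagonal_single, ← Matrix.diagonal_one, Matrix.diagonal_kronecker_diagonal,
      dephase_apply, Matrix.diag_diagonal]

/-- Detection incoherence says that the diagonal of `F ρ` depends only on that of `ρ`. By
self-adjointness of dephasing, the pulled-back basis measurement is then itself dephased. -/
theorem isIncoherentMeas_preprocess_single {F : SuperOp A X} (hF : IsDIO F) :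
    IsIncoherentMeas (preprocess (fun x => Matrix.single x x (1 : ℂ)) F) := by
  refine ⟨isPOVM_preprocess isPOVM_single (fun ρ hρ => posSemidef_of_isCP hF.1.1 hρ) hF.1.2,
    fun x => ?_⟩
  have h : ∀ ρ, (F ρ) x x = (F (dephase A ρ)) x x := by
    intro ρ
    have := congrFun (congrFun (LinearMap.congr_fun hF.2 ρ) x) x
    simpa [dephase_apply] using this
  refine (eq_preprocess fun ρ => ?_).symm
  rw [Matrix.trace_single_mul, h ρ, one_smul]
  have h2 : (dephase A (preprocess (fun x => Matrix.single x x (1 : ℂ)) F x) * ρ).trace =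
      (preprocess (fun x => Matrix.single x x (1 : ℂ)) F x * dephase A ρ).trace := by
    simp [dephase_apply, Matrix.trace]
  rw [h2, trace_preprocess_mul, Matrix.trace_single_mul, one_smul]

omit [Fintype A] [DecidableEq A] in
theorem kronecker_one_unique {K : Type} [Unique K] [DecidableEq K] (P : Matrix A A ℂ) :
    P ⊗ₖ (1 : Matrix K K ℂ) = P.submatrix (Equiv.prodUnique A K) (Equiv.prodUnique A K) := by
  ext i j
  simp [Matrix.one_apply, Subsingleton.elim i.2 j.2]

/-- Data processing for measurement channels. -/
theorem measRelEntropy_preprocess_measChannel_le [Nonempty A] {K Z : Type} [Fintype K]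
    [DecidableEq K] [Nonempty K] [Fintype Z] {M : Z → Matrix (X × K) (X × K) ℂ} (hM : IsPOVM M)
    {N F : X → Matrix A A ℂ} (hN : IsPOVM N) (hF : IsPOVM F) :
    measRelEntropy (preprocess M (tensorMap (measChannel N) (LinearMap.id : SuperOp K K)))
      (preprocess M (tensorMap (measChannel F) (LinearMap.id : SuperOp K K))) ≤
      measRelEntropy N F := by
  have h : ∀ N : X → Matrix A A ℂ,
      preprocess M (tensorMap (measChannel N) (LinearMap.id : SuperOp K K)) =
      fun z => ∑ x, N x ⊗ₖ (M z).submatrix (fun k => (x, k)) (fun k => (x, k)) :=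
    fun N => funext fun z => preprocess_tensorMap_measChannel M N z
  rw [h, h]
  refine measRelEntropy_kronecker_le hN.1 hF.1 (fun z x => (hM.1 z).submatrix _) fun x => ?_
  -- The diagonal blocks at a fixed `x` form a measurement on the ancilla, as they sum to a diagonal
  -- block of the identity.
  have h1 : ∑ z, (M z).submatrix (fun k => (x, k)) (fun k => (x, k)) =
      (∑ z, M z).submatrix (fun k : K => (x, k)) (fun k => (x, k)) := by
    ext i j
    simp [Matrix.sum_apply]
  rw [h1, hM.2]
  ext i j
  simp [Matrix.one_apply]

theorem cohPower_measChannel [Nonempty A] {N : X → Matrix A A ℂ} (hN : IsPOVM N) :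
    cohPower (measChannel N) = measCoherence N := by
  refine le_antisymm ?_ ?_
  · refine le_iInf₂ fun F hF => ?_
    refine iInf₂_le_of_le (measChannel F) (isDIO_measChannel hF) ?_
    refine iSup_le fun K => iSup_le fun _ => iSup_le fun _ => iSup_le fun _ => iSup_le fun Z =>
      iSup_le fun _ => iSup_le fun M => iSup_le fun hM => ?_
    exact measRelEntropy_preprocess_measChannel_le hM.1 hN hF.1
  · refine le_iInf₂ fun F hF => ?_
    have hI := isIncoherentMeas_preprocess_single hF
    refine iInf₂_le_of_le _ hI ?_
    -- The supremum is bounded below by the basis measurement with a one-dimensional ancilla.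
    refine le_iSup_of_le Unit <| le_iSup_of_le inferInstance <| le_iSup_of_le inferInstance <|
      le_iSup_of_le inferInstance <| le_iSup_of_le X <| le_iSup_of_le inferInstance <|
      le_iSup_of_le (fun x => Matrix.single x x (1 : ℂ) ⊗ₖ (1 : Matrix Unit Unit ℂ)) <|
      le_iSup_of_le isIncoherentMeas_single_kronecker_one ?_
    have h : ∀ E : SuperOp A X, preprocess
        (fun x => Matrix.single x x (1 : ℂ) ⊗ₖ (1 : Matrix Unit Unit ℂ))
        (tensorMap E (LinearMap.id : SuperOp Unit Unit)) =
        fun z => (preprocess (fun x => Matrix.single x x (1 : ℂ)) E z).submatrix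
          (Equiv.prodUnique A Unit) (Equiv.prodUnique A Unit) := fun E => funext fun z => by
      rw [preprocess_kronecker_one, kronecker_one_unique]
    rw [h, h, preprocess_single_measChannel, measRelEntropy_submatrix hN.1 hI.1.1]

theorem entPower_measChannel [Nonempty A] [Nonempty B] {N : X × Y → Matrix (A × B) (A × B) ℂ}
    (hN : IsPOVM N) : entPower (measChannel N) = measEntanglement N := by
  refine le_antisymm ?_ ?_
  · refine le_iInf₂ fun F hF => ?_
    refine iInf₂_le_of_le (measChannel F) (isClosedLOCC_measChannel hF) ?_
    refine iSup_le fun K => iSup_le fun _ => iSup_le fun _ => iSup_le fun _ => iSup_le fun L =>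
      iSup_le fun _ => iSup_le fun _ => iSup_le fun _ => iSup_le fun Z =>
      iSup_le fun _ => iSup_le fun _ => iSup_le fun M => iSup_le fun hM => ?_
    have hM' := hM.isPOVM
    have hM'' : IsPOVM fun z => (M z).submatrix (Equiv.prodProdProdComm X Y K L)
        (Equiv.prodProdProdComm X Y K L) := by
      refine ⟨fun z => (hM'.1 z).submatrix _, ?_⟩
      rw [← Matrix.submatrix_one_equiv (Equiv.prodProdProdComm X Y K L), ← hM'.2]
      ext i j
      simp only [Matrix.sum_apply, Matrix.submatrix_apply]
    have hpos : ∀ {R : X × Y → Matrix (A × B) (A × B) ℂ} (_ : IsPOVM R) (z : Z),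
        (preprocess (fun z => (M z).submatrix (Equiv.prodProdProdComm X Y K L)
          (Equiv.prodProdProdComm X Y K L)) (tensorMap (measChannel R)
          (LinearMap.id : SuperOp (K × L) (K × L))) z).PosSemidef := by
      intro R hR z
      rw [preprocess_tensorMap_measChannel]
      exact Matrix.posSemidef_sum _ fun x _ =>
        posSemidef_kronecker (hR.1 x) ((hM''.1 z).submatrix _)
    have h := fun E : SuperOp (A × B) (X × Y) => funext (preprocess_extendBipartite M E)
    rw [h, h, measRelEntropy_submatrix (hpos hN) (hpos hF.isPOVM)]
    exact measRelEntropy_preprocess_measChannel_le hM'' hN hF.isPOVM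
  · refine le_iInf₂ fun F hF => ?_
    have hI : IsClosedLOCCMeas (preprocess (fun z : X × Y => Matrix.single z z (1 : ℂ)) F) := by
      refine isClosedLOCCMeas_preprocess ?_ hF
      have := isLOCCMeas_kronecker (isPOVM_single (A := X)) (isPOVM_single (A := Y))
      simpa only [Matrix.single_kronecker_single, mul_one] using this
    refine iInf₂_le_of_le _ hI ?_
    have hU : ∀ {C : Type} [Fintype C] [DecidableEq C],
        IsPOVM fun c : C => Matrix.single (c, ()) (c, ()) (1 : ℂ) := by
      intro C _ _
      refine ⟨fun c => posSemidef_single _, ?_⟩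
      rw [← (isPOVM_single (A := C × Unit)).2, Fintype.sum_prod_type]
      simp
    -- The basis measurement with trivial ancillas on both sides, written as a product of local
    -- measurements so that it is visibly LOCC.
    have hL : IsLOCCMeas fun z : X × Y => Matrix.single (z.1, ()) (z.1, ()) (1 : ℂ) ⊗ₖ
        Matrix.single (z.2, ()) (z.2, ()) (1 : ℂ) :=
      isLOCCMeas_kronecker (P := fun x : X => Matrix.single (x, ()) (x, ()) (1 : ℂ))
        (Q := fun y : Y => Matrix.single (y, ()) (y, ()) (1 : ℂ)) hU hU
    refine le_iSup_of_le Unit <| le_iSup_of_le inferInstance <| le_iSup_of_le inferInstance <|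
      le_iSup_of_le inferInstance <| le_iSup_of_le Unit <| le_iSup_of_le inferInstance <|
      le_iSup_of_le inferInstance <| le_iSup_of_le inferInstance <| le_iSup_of_le (X × Y) <|
      le_iSup_of_le inferInstance <| le_iSup_of_le inferInstance <|
      le_iSup_of_le _ <| le_iSup_of_le (subset_closure hL) ?_
    have hM : ∀ z : X × Y, (Matrix.single (z.1, ()) (z.1, ()) (1 : ℂ) ⊗ₖ
        Matrix.single (z.2, ()) (z.2, ()) (1 : ℂ)).submatrix
          (Equiv.prodProdProdComm X Y Unit Unit) (Equiv.prodProdProdComm X Y Unit Unit) =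
        Matrix.single z z (1 : ℂ) ⊗ₖ (1 : Matrix (Unit × Unit) (Unit × Unit) ℂ) := by
      rintro ⟨x, y⟩
      ext ⟨⟨a, b⟩, ⟨⟩, ⟨⟩⟩ ⟨⟨c, d⟩, ⟨⟩, ⟨⟩⟩
      simp [Matrix.single_apply, ← ite_and]
      congr 1
      simp only [eq_iff_iff]
      tauto
    obtain ⟨e, he⟩ : ∃ e : (A × Unit) × (B × Unit) ≃ A × B, ∀ E : SuperOp (A × B) (X × Y),
        preprocess (fun z : X × Y => Matrix.single (z.1, ()) (z.1, ()) (1 : ℂ) ⊗ₖ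
          Matrix.single (z.2, ()) (z.2, ()) (1 : ℂ)) (extendBipartite Unit Unit E) =
        fun z => (preprocess (fun z => Matrix.single z z (1 : ℂ)) E z).submatrix e e := by
      let _ : Unique (Unit × Unit) := ⟨⟨((), ())⟩, fun _ => rfl⟩
      refine ⟨(Equiv.prodProdProdComm A Unit B Unit).trans
        (Equiv.prodUnique (A × B) (Unit × Unit)), fun E => funext fun z => ?_⟩
      rw [preprocess_extendBipartite]
      simp only [hM]
      rw [preprocess_kronecker_one, kronecker_one_unique, Matrix.submatrix_submatrix]
      rfl
    rw [he, he, preprocess_single_measChannel]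
    exact (measRelEntropy_submatrix hN.1 hI.isPOVM.1 e).ge

end Powers

end QuantumMeasurement

theorem theorem6 {A B X Y : Type}
    [Fintype A] [DecidableEq A] [Nonempty A] [Fintype B] [DecidableEq B] [Nonempty B]
    [Fintype X] [DecidableEq X] [Fintype Y] [DecidableEq Y] :
    (∀ N : X → Matrix A A ℂ, QuantumMeasurement.IsPOVM N →
      QuantumMeasurement.cohPower (QuantumMeasurement.measChannel N) =
        QuantumMeasurement.measCoherence N) ∧
    (∀ N : X × Y → Matrix (A × B) (A × B) ℂ, QuantumMeasurement.IsPOVM N →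
      QuantumMeasurement.entPower (QuantumMeasurement.measChannel N) =
        QuantumMeasurement.measEntanglement N) :=
  ⟨fun _ hN => QuantumMeasurement.cohPower_measChannel hN,
    fun _ hN => QuantumMeasurement.entPower_measChannel hN⟩
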